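/- Let $d,j$ be integers with $1\le j\le d-2$ (so $d\ge 3$). Let $\mathcal K$ be the set of non-empty compact convex subsets (convex bodies) of $\mathbb R^d$ with the Hausdorff metric, and $\mathcal P\subset\mathcal K$ the set of convex polytopes. For $P\in\mathcal P$ let $\mathcal F_j(P)$ be the set of $j$-dimensional faces of $P$ (including $P$ itself if $\dim P=j$); for $F\in\mathcal F_j(P)$ let $V_j(F)$ be its $j$-dimensional volume and $n(P,F)$ the intersection of the normal cone of $P$ at $F$ with the unit sphere $S^{d-1}$. A spherical polytope is the intersection $p$ of $S^{d-1}$ with a finitely generated convex cone; $\langle p\rangle$ is its linear span and $\dim p=\dim\langle p\rangle-1$. Let $\wp_{m}$ be the class of spherical polytopes of dimension at most $m$. Let $F(d,q)=\{(u,L): L\subset\mathbb R^d \text{ a } q\text{-dimensional linear subspace},\ u\in L\cap S^{d-1}\}$ be the flag manifold with its usual topology, and $\mathcal H^m$ the $m$-dimensional Hausdorff measure. A function $\varphi:\mathcal P\to\mathbb R$ is a valuation if $\varphi(P\cup Q)+\varphi(P\cap Q)=\varphi(P)+\varphi(Q)$ whenever $P,Q,P\cup Q\in\mathcal P$; it is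 $j$-homogeneous if $\varphi(rP)=r^j\varphi(P)$ for all $P\in\mathcal P$, $r\ge0$. A $j$-homogeneous translation invariant valuation $\varphi$ on $\mathcal P$ is flag-continuous if there is a function $f:\wp_{d-j-1}\to\mathbb R$ which is additive ($f(p\cup q)+f(p\cap q)=f(p)+f(q)$ whenever $p,q,p\cup q\in\wp_{d-j-1}$) and simple ($f(p)=0$ whenever $\dim p<d-j-1$), such that $$\varphi(P)=\sum_{F\in\mathcal F_j(P)}f(n(P,F))\,V_j(F)\qquad\text{for all }P\in\mathcal P,$$ and a continuous function $\tilde f:F(d,d-j)\to\mathbb R$ with $$f(p)=\int_p\tilde f(u,\langle p\rangle)\,\mathcal H^{d-j-1}(du)\qquad\text{for all } p\in\wp_{d-j-1}\text{ with }\dim p=d-j-1.$$ **Theorem 2.1.** For every $d$ and every $j\in\{1,\dots,d-2\}$ there is a flag-continuous, $j$-homogeneous, translation invariant valuation $\varphi$ on $\mathcal P$ and a convex body $K\in\mathcal K$ for which there are sequences $(P_k)$, $(Q_k)$ of polytopes with $P_k\to K$ and $Q_k\to K$ such that the limits $\lim_{k\to\infty}\varphi(P_k)$ and $\lim_{k\to\infty}\varphi(Q_k)$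 exist in $\mathbb R$ and $$\lim_{k\to\infty}\varphi(P_k)\neq\lim_{k\to\infty}\varphi(Q_k).$$ In particular, $\varphi$ has no extension to a continuous function on $\mathcal K$. -/

import Mathlib

open scoped Pointwise Topology MeasureTheory

/-- Euclidean space `ℝ^d` with its standard scalar product and norm. -/
abbrev Euc (d : ℕ) : Type := EuclideanSpace ℝ (Fin d)

/-- A (non-empty, convex) polytope: the convex hull of a non-empty finite set of points. -/
def IsPolytope {d : ℕ} (P : Set (Euc d)) : Prop :=
  ∃ s : Finset (Euc d), s.Nonempty ∧ P = convexHull ℝ (s : Set (Euc d))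

/-- `F_j(P)`, the set of `j`-dimensional faces of a polytope `P`. The non-empty faces of a polytope
are `P` itself and its intersections with supporting hyperplanes, that is, the non-empty sets of
maximum points in `P` of a linear functional (the zero functional gives `P`). -/
def polytopeFaces {d : ℕ} (j : ℕ) (P : Set (Euc d)) : Set (Set (Euc d)) :=
  {F | F.Nonempty ∧ IsExposed ℝ P F ∧ Module.finrank ℝ (vectorSpan ℝ F) = j}

/-- A polytope has only finitely many `j`-faces, so that sums over them written with `∑ᶠ` are
genuine finite sums. -/
theorem polytopeFaces_finite {d : ℕ} (j : ℕ) {P : Set (Euc d)} (hP : IsPolytope P) :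
    (polytopeFaces j P).Finite := by
  obtain ⟨s, -, rfl⟩ := hP
  have hfin : (Set.extremePoints ℝ (convexHull ℝ (s : Set (Euc d)))).Finite :=
    s.finite_toSet.subset extremePoints_convexHull_subset
  have hcomp : IsCompact (convexHull ℝ (s : Set (Euc d))) :=
    s.finite_toSet.isCompact_convexHull ℝ
  refine Set.Finite.of_finite_image
    (f := fun F => F ∩ Set.extremePoints ℝ (convexHull ℝ (s : Set (Euc d)))) ?_ ?_
  · refine hfin.finite_subsets.subset ?_
    rintro _ ⟨F, -, rfl⟩
    exact Set.inter_subset_right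
  · have key : ∀ F ∈ polytopeFaces j (convexHull ℝ (s : Set (Euc d))),
        closure (convexHull ℝ (F ∩ Set.extremePoints ℝ (convexHull ℝ (s : Set (Euc d))))) = F := by
      rintro F ⟨-, hF, -⟩
      rw [← hF.isExtreme.extremePoints_eq]
      exact closure_convexHull_extremePoints (hF.isCompact hcomp)
        (hF.convex (convex_convexHull ℝ _))
    intro F hF G hG h
    simp only at h
    rw [← key F hF, ← key G hG, h]

/-- `V_j(F)` for a `j`-dimensional convex set `F`: its `j`-dimensional volume, i.e. the value of the
`j`-dimensional Hausdorff measure, normalised to agree with Lebesgue measure. -/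
noncomputable def faceVolume {d : ℕ} (j : ℕ) (F : Set (Euc d)) : ℝ :=
  (μHE[j] : MeasureTheory.Measure (Euc d)).real F

/-- `n(P, F)`, the intersection of the normal cone of `P` at its face `F` with the unit sphere: the
unit vectors `u` such that every point of `F` maximises `⟪u, ·⟫` over `P`. -/
def sphericalNormal {d : ℕ} (P F : Set (Euc d)) : Set (Euc d) :=
  {u | ‖u‖ = 1 ∧ ∀ x ∈ F, ∀ y ∈ P, inner ℝ u y ≤ inner ℝ u x}

/-- A spherical polytope: the intersection of the unit sphere with a polyhedral
(finitely generated) convex cone. Its dimension is `dim ⟨p⟩ - 1`, where `⟨p⟩` is its linear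
span. -/
def IsSphericalPolytope {d : ℕ} (p : Set (Euc d)) : Prop :=
  ∃ s : Finset (Euc d),
    p = (PointedCone.hull ℝ (s : Set (Euc d)) : Set (Euc d)) ∩ Metric.sphere 0 1

/-- The class of spherical polytopes `p` with `dim ⟨p⟩ ≤ q`, i.e. of dimension at most `q - 1`. -/
def sphericalPolytopes (d q : ℕ) : Set (Set (Euc d)) :=
  {p | IsSphericalPolytope p ∧ Module.finrank ℝ (Submodule.span ℝ p) ≤ q}

/-- The usual topology on the linear subspaces of `ℝ^d`: `L` is identified with the orthogonal
projection onto `L`, with the operator norm. Its restriction to the subspaces of dimension `q` is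
the usual topology of the Grassmannian `G(d, q)`. -/
noncomputable instance Euc.topologicalSpaceSubmodule (d : ℕ) :
    TopologicalSpace (Submodule ℝ (Euc d)) :=
  TopologicalSpace.induced (fun L => L.starProjection) inferInstance

/-- The flag manifold `F(d, q)` of all pairs `(u, L)` of a unit vector `u` and a `q`-dimensional
linear subspace `L` of `ℝ^d` with `u ∈ L`. -/
def flagManifold (d q : ℕ) : Set (Euc d × Submodule ℝ (Euc d)) :=
  {x | ‖x.1‖ = 1 ∧ Module.finrank ℝ x.2 = q ∧ x.1 ∈ x.2}

/-- `φ` (of which only the values on polytopes matter) is a valuation on polytopes. -/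
def IsPolytopeValuation {d : ℕ} (φ : Set (Euc d) → ℝ) : Prop :=
  ∀ P Q : Set (Euc d), IsPolytope P → IsPolytope Q → IsPolytope (P ∪ Q) →
    φ (P ∪ Q) + φ (P ∩ Q) = φ P + φ Q

/-- Translation invariance on polytopes. -/
def IsTranslationInvariant {d : ℕ} (φ : Set (Euc d) → ℝ) : Prop :=
  ∀ P : Set (Euc d), IsPolytope P → ∀ x : Euc d, φ (x +ᵥ P) = φ P

/-- Homogeneity of degree `j` on polytopes. -/
def IsHomogeneousOfDegree {d : ℕ} (j : ℕ) (φ : Set (Euc d) → ℝ) : Prop :=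
  ∀ P : Set (Euc d), IsPolytope P → ∀ r : ℝ, 0 ≤ r → φ (r • P) = r ^ j * φ P

/-- `f` is an associated function of the `j`-homogeneous functional `φ`: it is a simple, additive
functional on the spherical polytopes of dimension at most `d - j - 1`, and
`φ(P) = ∑_{F ∈ F_j(P)} f(n(P, F)) V_j(F)` for every polytope `P`. -/
structure IsAssociatedFunction {d : ℕ} (j : ℕ) (φ f : Set (Euc d) → ℝ) : Prop where
  simple : ∀ p ∈ sphericalPolytopes d (d - j),
    Module.finrank ℝ (Submodule.span ℝ p) < d - j → f p = 0
  additive : ∀ p ∈ sphericalPolytopes d (d - j), ∀ q ∈ sphericalPolytopes d (d - j),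
    p ∪ q ∈ sphericalPolytopes d (d - j) → f (p ∪ q) + f (p ∩ q) = f p + f q
  eq_sum : ∀ P : Set (Euc d), IsPolytope P →
    φ P = ∑ᶠ F ∈ polytopeFaces j P, f (sphericalNormal P F) * faceVolume j F

/-- `φ` is flag-continuous (in degree `j`): it has an associated function `f` for which there is a
continuous function `g` on `F(d, d - j)` with `f(p) = ∫_p g(u, ⟨p⟩) H^{d-j-1}(du)` for all
spherical polytopes `p` of dimension `d - j - 1`. -/
def IsFlagContinuous {d : ℕ} (j : ℕ) (φ : Set (Euc d) → ℝ) : Prop :=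
  ∃ f : Set (Euc d) → ℝ, IsAssociatedFunction j φ f ∧
    ∃ g : Euc d × Submodule ℝ (Euc d) → ℝ, ContinuousOn g (flagManifold d (d - j)) ∧
      ∀ p ∈ sphericalPolytopes d (d - j), Module.finrank ℝ (Submodule.span ℝ p) = d - j →
        f p = ∫ u in p, g (u, Submodule.span ℝ p)
          ∂(μHE[d - j - 1] : MeasureTheory.Measure (Euc d))

/-!
The flag valuation with continuous density `g` is
`φ(P) = ∑_F (∫_{n(P, F)} g(u, ⟨n(P, F)⟩) du) V_j(F)`, summed over the `j`-faces of `P`. For a fixed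
direction space `M` of dimension `j`, almost every unit normal `u` of `M` is such that the support set
`F(P, u)` of `P` is parallel to a subspace of `M` (`ae_vectorSpan_supportSet_le`); hence
`φ(P)` is also the sum over all `M` of `∫ g(u, Mᗮ) V_j(F(P, u)) du`, the integral being over the unit
normals of `M` (`flagValuation_eq_finsum`). This is how `φ` is defined here, since for a fixed
direction `u` the passage to support sets `F(P, u)` commutes with translations and dilatations, and
turns a convex union `P ∪ Q` into either a union or one of the two sets. So all the invariance
properties and the valuation property hold under the integral, and the latter does not need that
`P ∩ Q` is a polytope.

For the discontinuity consider first `j = 1` and `d = 3`. For a rotation `(c, s)` of the horizontal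
plane let `Z` be the sum of the segments `[-v, v] / N` with `v = (c, s, b)` and `v = (-s, c, b)`,
where `b` runs through `N` equidistant points of `[-1, 1]`. The average of `|x + b z|` over `b` tends
to `(x² + z²) / (2 |z|)` for `|x| ≤ |z|`, so that for `x² + y² ≤ z²` the support function of `Z`
tends to `(x² + y² + 2 z²) / (2 |z|)`, independently of the rotation. The convex hull of `Z` and of a
large horizontal square has the maximum of two support functions as its support function, and the
square dominates for `x² + y² > z²`. So these hulls tend to the same convex body `K` for all
rotations (`exists_tendsto_of_supportFunction`). The edges with normals close to `-e₂`, on the other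
hand, are those of `Z`, and their directions do depend on the rotation. The density is
`κ(u) ⟪p_M e₀, e₁⟫²`, where `κ` is supported in a small cap around `-e₂` and `p_M` is the orthogonal
projection to the direction `M` of the edge. Then `φ` vanishes for `(c, s) = (1, 0)`; for
`(c, s) = (3/5, 4/5)` it is bounded, and bounded below by a positive constant, so that it has a
positive limit along a subsequence.

For general `d` and `j` the polytopes are multiplied by a cube of dimension `n = j - 1` in further
coordinates, and `g` gets a factor that vanishes unless `M` contains all edges of the cube. Then the
value of `φ` is a sum over the generators of `Z` (`flagValuation_gridBody`), each of which
contributes the volume of a box of dimension `j`.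
-/

/-! ### Euclidean Hausdorff measure of spheres, caps and boxes -/

section HausdorffMeasure

open MeasureTheory Measure Module

variable {E : Type*} [NormedAddCommGroup E] [InnerProductSpace ℝ E] [FiniteDimensional ℝ E]
  [MeasurableSpace E] [BorelSpace E]

theorem LipschitzOnWith.euclideanHausdorffMeasure_image_le {X Y : Type*} [EMetricSpace X]
    [MeasurableSpace X] [BorelSpace X] [EMetricSpace Y] [MeasurableSpace Y] [BorelSpace Y]
    {K : NNReal} {f : X → Y} {s : Set X} (h : LipschitzOnWith K f s) (k : ℕ) :
    (μHE[k] : Measure Y) (f '' s) ≤ (K : ENNReal) ^ k * (μHE[k] : Measure X) s := by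
  simp_rw [euclideanHausdorffMeasure_def, Measure.smul_apply, ENNReal.smul_def, smul_eq_mul]
  have := h.hausdorffMeasure_image_le (d := k) (by positivity)
  rw [ENNReal.rpow_natCast] at this
  rw [mul_left_comm]
  gcongr

theorem euclideanHausdorffMeasure_submodule_lt_top (M : Submodule ℝ E) {s : Set E}
    (hs : Bornology.IsBounded s) (hM : s ⊆ M) :
    (μHE[finrank ℝ M] : Measure E) s < ⊤ := by
  have h : (Subtype.val : M → E) '' (Subtype.val ⁻¹' s) = s :=
    Set.image_preimage_eq_of_subset (by simpa using hM)
  rw [← h, Isometry.euclideanHausdorffMeasure_image isometry_subtype_coe]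
  exact (isometry_subtype_coe.antilipschitz.isBounded_preimage hs).measure_lt_top

omit [InnerProductSpace ℝ E] [FiniteDimensional ℝ E] in
theorem euclideanHausdorffMeasure_eq_zero_of_lt {k m : ℕ} (hkm : k < m) {s : Set E}
    (hs : (μHE[k] : Measure E) s < ⊤) : (μHE[m] : Measure E) s = 0 :=
  (euclideanHausdorffMeasure_zero_or_top hkm s).resolve_right hs.ne

theorem euclideanHausdorffMeasure_vectorSpan_lt_top {s : Set E} (hs : Bornology.IsBounded s) :
    (μHE[finrank ℝ (vectorSpan ℝ s)] : Measure E) s < ⊤ := by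
  rcases s.eq_empty_or_nonempty with rfl | ⟨x, hx⟩
  · simp
  have h := euclideanHausdorffMeasure_submodule_lt_top (vectorSpan ℝ s) (s := -x +ᵥ s)
    (hs.vadd _) (by
      rintro _ ⟨y, hy, rfl⟩
      have := vsub_mem_vectorSpan ℝ hy hx
      simpa [sub_eq_neg_add] using this)
  rwa [measure_vadd] at h

theorem euclideanHausdorffMeasure_lt_top_of_finrank_le {s : Set E} (hs : Bornology.IsBounded s)
    {k : ℕ} (hk : finrank ℝ (vectorSpan ℝ s) ≤ k) : (μHE[k] : Measure E) s < ⊤ := by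
  rcases hk.eq_or_lt with rfl | hlt
  · exact euclideanHausdorffMeasure_vectorSpan_lt_top hs
  · rw [euclideanHausdorffMeasure_eq_zero_of_lt hlt
      (euclideanHausdorffMeasure_vectorSpan_lt_top hs)]
    exact ENNReal.zero_lt_top

theorem euclideanHausdorffMeasure_eq_zero_of_finrank_lt {s : Set E} (hs : Bornology.IsBounded s)
    {k : ℕ} (hk : finrank ℝ (vectorSpan ℝ s) < k) : (μHE[k] : Measure E) s = 0 :=
  euclideanHausdorffMeasure_eq_zero_of_lt hk (euclideanHausdorffMeasure_vectorSpan_lt_top hs)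

omit [FiniteDimensional ℝ E] [MeasurableSpace E] [BorelSpace E] in
theorem hemisphere_subset_image_stereoInvFunAux {v : E} (hv : ‖v‖ = 1) :
    {x : E | ‖x‖ = 1 ∧ inner ℝ v x ≤ 0} ⊆
      stereoInvFunAux v '' (((ℝ ∙ v)ᗮ : Submodule ℝ E) ∩ Metric.closedBall 0 2) := by
  rintro x ⟨hx, ha⟩
  set a : ℝ := inner ℝ v x with ha'
  have h1 : (0 : ℝ) < 1 - a := by linarith
  have hvv : inner ℝ v v = 1 := by rw [real_inner_self_eq_norm_sq, hv]; norm_num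
  have hxx : inner ℝ x x = 1 := by rw [real_inner_self_eq_norm_sq, hx]; norm_num
  have hxv : inner ℝ x v = a := by rw [real_inner_comm]
  have hnorm : ‖(2 / (1 - a)) • (x - a • v)‖ ^ 2 = 4 * (1 + a) / (1 - a) := by
    rw [← real_inner_self_eq_norm_sq]
    simp only [inner_smul_left, inner_smul_right, inner_sub_left, inner_sub_right, hvv, hxx, hxv,
      ← ha', conj_trivial]
    field_simp
    ring
  refine ⟨(2 / (1 - a)) • (x - a • v), ⟨?_, ?_⟩, ?_⟩
  · rw [SetLike.mem_coe, Submodule.mem_orthogonal_singleton_iff_inner_right]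
    rw [inner_smul_right, inner_sub_right, inner_smul_right, hvv, ← ha', mul_one, sub_self, mul_zero]
  · rw [mem_closedBall_zero_iff]
    refine abs_le_of_sq_le_sq' ?_ (by norm_num) |>.2
    rw [hnorm, div_le_iff₀ h1]
    linarith
  · rw [stereoInvFunAux_apply, hnorm]
    have h2 : (4 * (1 + a) / (1 - a) + 4) = 8 / (1 - a) := by field_simp; ring
    have h3 : (4 * (1 + a) / (1 - a) - 4) = 8 * a / (1 - a) := by field_simp; ring
    rw [h2, h3]
    match_scalars <;> field_simp <;> ring

/-- The unit sphere has finite Hausdorff measure in its own dimension: two hemispheres are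
Lipschitz images, under inverse stereographic projection, of discs in a hyperplane. -/
theorem euclideanHausdorffMeasure_sphere_lt_top {n : ℕ} (hn : finrank ℝ E = n + 1) :
    (μHE[n] : Measure E) (Metric.sphere 0 1) < ⊤ := by
  have hemi : ∀ v : E, ‖v‖ = 1 →
      (μHE[n] : Measure E) {x : E | ‖x‖ = 1 ∧ inner ℝ v x ≤ 0} < ⊤ := by
    intro v hv
    have hv0 : v ≠ 0 := by rintro rfl; simp at hv
    obtain ⟨K, hK⟩ := LocallyLipschitzOn.exists_lipschitzOnWith_of_compact
      (isCompact_closedBall (0 : E) 2)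
      ((contDiff_stereoInvFunAux (v := v) (m := 1)).locallyLipschitz.locallyLipschitzOn)
    refine (measure_mono (hemisphere_subset_image_stereoInvFunAux hv)).trans_lt ?_
    refine ((hK.mono Set.inter_subset_right).euclideanHausdorffMeasure_image_le n).trans_lt ?_
    have : Fact (finrank ℝ E = n + 1) := ⟨hn⟩
    have hr : finrank ℝ (ℝ ∙ v)ᗮ = n := Submodule.finrank_orthogonal_span_singleton hv0
    refine ENNReal.mul_lt_top (by finiteness) ?_
    have := euclideanHausdorffMeasure_submodule_lt_top (ℝ ∙ v)ᗮ
      (Metric.isBounded_closedBall.subset Set.inter_subset_right) Set.inter_subset_left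
      (s := ((ℝ ∙ v)ᗮ : Submodule ℝ E) ∩ Metric.closedBall 0 2)
    rwa [hr] at this
  have : Nontrivial E := nontrivial_of_finrank_pos (R := ℝ) (by omega)
  obtain ⟨v, hv⟩ := exists_norm_eq E zero_le_one
  refine (measure_mono ?_).trans_lt
    ((measure_union_le _ _).trans_lt (ENNReal.add_lt_top.2 ⟨hemi v hv, hemi (-v) (by simpa)⟩))
  intro x hx
  rw [mem_sphere_zero_iff_norm] at hx
  rcases le_total (inner ℝ v x) 0 with h | h
  · exact Or.inl ⟨hx, h⟩
  · exact Or.inr ⟨hx, by simpa [inner_neg_left] using h⟩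

theorem euclideanHausdorffMeasure_inter_sphere_eq (L : Submodule ℝ E) (n k : ℕ)
    (hL : finrank ℝ L = n) : (μHE[k] : Measure E) (L ∩ Metric.sphere 0 1) =
      (μHE[k] : Measure (EuclideanSpace ℝ (Fin n))) (Metric.sphere 0 1) := by
  have e := ((stdOrthonormalBasis ℝ L).reindex (finCongr hL)).repr.symm
  rw [← (isometry_subtype_coe.comp e.isometry).euclideanHausdorffMeasure_image]
  congr 1
  ext x
  simp only [Set.mem_inter_iff, SetLike.mem_coe, mem_sphere_iff_norm, sub_zero, Set.mem_image,
    Function.comp_apply]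
  constructor
  · rintro ⟨hx, hn⟩
    exact ⟨e.symm ⟨x, hx⟩, by simpa using hn, by simp⟩
  · rintro ⟨y, hy, rfl⟩
    exact ⟨(e y).2, by rw [Submodule.norm_coe, e.norm_map]; simpa using hy⟩

theorem euclideanHausdorffMeasure_inter_sphere_lt_top (L : Submodule ℝ E) {n : ℕ}
    (hL : finrank ℝ L = n + 1) : (μHE[n] : Measure E) (L ∩ Metric.sphere 0 1) < ⊤ := by
  rw [euclideanHausdorffMeasure_inter_sphere_eq L (n + 1) n hL]
  exact euclideanHausdorffMeasure_sphere_lt_top (by simp)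

theorem euclideanHausdorffMeasure_inter_sphere_eq_zero (L : Submodule ℝ E) {n : ℕ}
    (hL : finrank ℝ L ≤ n) : (μHE[n] : Measure E) (L ∩ Metric.sphere 0 1) = 0 := by
  rcases h : finrank ℝ L with _ | m
  · have h0 : L = ⊥ := Submodule.finrank_eq_zero.1 h
    have : ((L : Set E) ∩ Metric.sphere 0 1) = ∅ := by
      ext x
      simp only [h0, Submodule.bot_coe, Set.mem_inter_iff, Set.mem_singleton_iff,
        mem_sphere_iff_norm, sub_zero, Set.mem_empty_iff_false, iff_false, not_and]
      rintro rfl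
      simp
    rw [this, measure_empty]
  · exact euclideanHausdorffMeasure_eq_zero_of_lt (by omega)
      (euclideanHausdorffMeasure_inter_sphere_lt_top L h)

/-- A cap of a great subsphere is at least as large as the disc of half its radius, which is
contained in its orthogonal projection to the tangent space of its centre. -/
theorem euclideanHausdorffMeasure_closedBall_le_cap (L : Submodule ℝ E) {n : ℕ}
    (hL : finrank ℝ L = n + 1) {w : E} (hw : w ∈ L) (hw1 : ‖w‖ = 1) {δ : ℝ} (hδ : 0 ≤ δ)
    (hδ1 : δ ≤ 1) :
    (μHE[n] : Measure (EuclideanSpace ℝ (Fin n))) (Metric.closedBall 0 (δ / 2)) ≤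
      (μHE[n] : Measure E) {u | u ∈ L ∧ ‖u‖ = 1 ∧ ‖u - w‖ ≤ δ} := by
  set w' : L := ⟨w, hw⟩ with hw'
  have hw'0 : w' ≠ 0 := by
    intro h
    have : w = 0 := congrArg Subtype.val h
    simp [this] at hw1
  have hw'1 : ‖w'‖ = 1 := hw1
  have : Fact (finrank ℝ L = n + 1) := ⟨hL⟩
  set V : Submodule ℝ L := (ℝ ∙ w')ᗮ with hV
  have hr : finrank ℝ V = n := Submodule.finrank_orthogonal_span_singleton hw'0
  set A : Set L := {u | ‖u‖ = 1 ∧ ‖u - w'‖ ≤ δ} with hA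
  have himg : {u | u ∈ L ∧ ‖u‖ = 1 ∧ ‖u - w‖ ≤ δ} = Subtype.val '' A := by
    ext u
    constructor
    · rintro ⟨h1, h2, h3⟩
      exact ⟨⟨u, h1⟩, ⟨h2, h3⟩, rfl⟩
    · rintro ⟨u, ⟨h1, h2⟩, rfl⟩
      exact ⟨u.2, h1, h2⟩
  rw [himg, Isometry.euclideanHausdorffMeasure_image isometry_subtype_coe]
  have hball : Metric.closedBall (0 : V) (δ / 2) ⊆ V.orthogonalProjectionOnto '' A := by
    intro y hy
    rw [mem_closedBall_zero_iff] at hy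
    have hy0 : 0 ≤ ‖y‖ := norm_nonneg _
    have hy2 : ‖y‖ ^ 2 ≤ 1 := by nlinarith
    set t : ℝ := Real.sqrt (1 - ‖y‖ ^ 2) with ht
    have ht0 : 0 ≤ t := Real.sqrt_nonneg _
    have ht2 : t ^ 2 = 1 - ‖y‖ ^ 2 := Real.sq_sqrt (by linarith)
    have hyw : inner ℝ (y : L) w' = 0 :=
      Submodule.mem_orthogonal_singleton_iff_inner_left.1 y.2
    refine ⟨(y : L) + t • w', ⟨?_, ?_⟩, ?_⟩
    · have : ‖(y : L) + t • w'‖ ^ 2 = 1 := by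
        rw [norm_add_sq_real, inner_smul_right, hyw, norm_smul, hw'1, Real.norm_eq_abs, mul_one,
          sq_abs, ht2]
        simp
      nlinarith [norm_nonneg ((y : L) + t • w')]
    · have h : (y : L) + t • w' - w' = (y : L) + (t - 1) • w' := by module
      have : ‖(y : L) + (t - 1) • w'‖ ^ 2 = ‖y‖ ^ 2 + (t - 1) ^ 2 := by
        rw [norm_add_sq_real, inner_smul_right, hyw, norm_smul, hw'1, Real.norm_eq_abs, mul_one,
          sq_abs]
        simp
      rw [h]
      refine abs_le_of_sq_le_sq' ?_ hδ |>.2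
      rw [this]
      have : t ≤ 1 := by nlinarith
      nlinarith
    · have h1 : V.orthogonalProjectionOnto (y : L) = y :=
        Submodule.orthogonalProjectionOnto_mem_subspace_eq_self y
      have h2 : V.orthogonalProjectionOnto w' = 0 :=
        Submodule.orthogonalProjectionOnto_eq_zero_iff.2
          (Submodule.le_orthogonal_orthogonal _ (Submodule.mem_span_singleton_self _))
      rw [map_add, map_smul, h1, h2, smul_zero, add_zero]
  have e := ((stdOrthonormalBasis ℝ V).reindex (finCongr hr)).repr.symm
  calc (μHE[n] : Measure (EuclideanSpace ℝ (Fin n))) (Metric.closedBall 0 (δ / 2))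
      = (μHE[n] : Measure V) (e '' Metric.closedBall 0 (δ / 2)) :=
        (e.isometry.euclideanHausdorffMeasure_image _).symm
    _ = (μHE[n] : Measure V) (Metric.closedBall 0 (δ / 2)) := by
        rw [e.image_closedBall, map_zero]
    _ ≤ (μHE[n] : Measure V) (V.orthogonalProjectionOnto '' A) := measure_mono hball
    _ ≤ (μHE[n] : Measure L) A := by
        simpa using (V.lipschitzWith_orthogonalProjectionOnto.lipschitzOnWith
          (s := A)).euclideanHausdorffMeasure_image_le n

omit [FiniteDimensional ℝ E] in
theorem euclideanHausdorffMeasure_orthonormal_box {k : ℕ} {m : Fin k → E} (hm : Orthonormal ℝ m)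
    {l : Fin k → ℝ} (hl : ∀ i, 0 ≤ l i) :
    (μHE[k] : Measure E) ((fun t : Fin k → ℝ => ∑ i, t i • m i) '' Set.Icc (-l) l) =
      ENNReal.ofReal (∏ i, (2 * l i)) := by
  let f : EuclideanSpace ℝ (Fin k) →ₗ[ℝ] E :=
    { toFun := fun t => ∑ i, t i • m i
      map_add' := fun x y => by simp [add_smul, Finset.sum_add_distrib]
      map_smul' := fun r x => by simp [Finset.smul_sum, mul_smul] }
  have hf : Isometry f := by
    refine AddMonoidHomClass.isometry_of_norm f fun x => ?_
    have : ‖f x‖ ^ 2 = ‖x‖ ^ 2 := by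
      rw [← real_inner_self_eq_norm_sq]
      change inner ℝ (∑ i, x i • m i) (∑ i, x i • m i) = _
      rw [hm.inner_sum, EuclideanSpace.norm_sq_eq]
      simp [pow_two]
    exact (sq_eq_sq₀ (norm_nonneg _) (norm_nonneg _)).1 this
  have himg : (fun t : Fin k → ℝ => ∑ i, t i • m i) '' Set.Icc (-l) l =
      f '' ((MeasurableEquiv.toLp 2 (Fin k → ℝ)).symm ⁻¹' Set.Icc (-l) l) := by
    ext x
    constructor
    · rintro ⟨t, ht, rfl⟩
      exact ⟨WithLp.toLp 2 t, ht, rfl⟩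
    · rintro ⟨t, ht, rfl⟩
      exact ⟨_, ht, rfl⟩
  rw [himg, hf.euclideanHausdorffMeasure_image,
    EuclideanSpace.euclideanHausdorffMeasure_eq_volume,
    (EuclideanSpace.volume_preserving_symm_measurableEquiv_toLp (Fin k)).measure_preimage
      measurableSet_Icc.nullMeasurableSet,
    Real.volume_Icc_pi, ENNReal.ofReal_prod_of_nonneg (fun i _ => by linarith [hl i])]
  refine Finset.prod_congr rfl fun i _ => ?_
  rw [Pi.neg_apply]
  congr 1
  ring

end HausdorffMeasure

/-! ### Support sets and faces of polytopes -/

section SupportSet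

variable {E : Type*} [NormedAddCommGroup E] [InnerProductSpace ℝ E]

/-- The support set `F(P, u)`: the points of `P` at which `⟪u, ·⟫` is maximal. -/
def supportSet (P : Set E) (u : E) : Set E :=
  {x | x ∈ P ∧ ∀ y ∈ P, inner ℝ u y ≤ inner ℝ u x}

theorem supportSet_subset (P : Set E) (u : E) : supportSet P u ⊆ P := fun _ h => h.1

theorem isExposed_supportSet (P : Set E) (u : E) : IsExposed ℝ P (supportSet P u) :=
  fun _ => ⟨innerSL ℝ u, rfl⟩

theorem supportSet_nonempty {P : Set E} (hP : IsCompact P) (hne : P.Nonempty) (u : E) :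
    (supportSet P u).Nonempty := by
  obtain ⟨x, hx, h⟩ := hP.exists_isMaxOn hne (f := fun y => (inner ℝ u y : ℝ)) (by fun_prop)
  exact ⟨x, hx, fun y hy => h hy⟩

theorem inner_eq_of_mem_supportSet {P : Set E} {u x y : E} (hx : x ∈ supportSet P u)
    (hy : y ∈ supportSet P u) : inner ℝ u x = inner ℝ u y :=
  le_antisymm (hy.2 x hx.1) (hx.2 y hy.1)

theorem mem_orthogonal_vectorSpan {F : Set E} {u : E}
    (h : ∀ x ∈ F, ∀ y ∈ F, inner ℝ u x = inner ℝ u y) : u ∈ (vectorSpan ℝ F)ᗮ := by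
  rw [Submodule.mem_orthogonal', vectorSpan_def]
  intro w hw
  induction hw using Submodule.span_induction with
  | mem z hz =>
    obtain ⟨x, hx, y, hy, rfl⟩ := hz
    change inner ℝ u (x - y) = 0
    rw [inner_sub_right, h x hx y hy, sub_self]
  | zero => simp
  | add a b _ _ ha hb => rw [inner_add_right, ha, hb, add_zero]
  | smul c a _ ha => rw [inner_smul_right, ha, mul_zero]

theorem mem_orthogonal_vectorSpan_supportSet (P : Set E) (u : E) :
    u ∈ (vectorSpan ℝ (supportSet P u))ᗮ :=
  mem_orthogonal_vectorSpan fun _ hx _ hy => inner_eq_of_mem_supportSet hx hy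

theorem supportSet_add (A B : Set E) (u : E) :
    supportSet (A + B) u = supportSet A u + supportSet B u := by
  ext x
  constructor
  · rintro ⟨⟨a, ha, b, hb, rfl⟩, h⟩
    refine ⟨a, ⟨ha, fun y hy => ?_⟩, b, ⟨hb, fun y hy => ?_⟩, rfl⟩
    · have := h (y + b) ⟨y, hy, b, hb, rfl⟩
      simp only [inner_add_right] at this
      linarith
    · have := h (a + y) ⟨a, ha, y, hy, rfl⟩
      simp only [inner_add_right] at this
      linarith
  · rintro ⟨a, ha, b, hb, rfl⟩
    refine ⟨⟨a, ha.1, b, hb.1, rfl⟩, ?_⟩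
    rintro _ ⟨a', ha', b', hb', rfl⟩
    simp only [inner_add_right]
    linarith [ha.2 a' ha', hb.2 b' hb']

theorem supportSet_singleton (x u : E) : supportSet {x} u = {x} := by
  ext y
  simp only [supportSet, Set.mem_singleton_iff, forall_eq, Set.mem_ofPred_eq]
  exact ⟨fun h => h.1, fun h => ⟨h, by rw [h]⟩⟩

theorem supportSet_vadd (x : E) (P : Set E) (u : E) :
    supportSet (x +ᵥ P) u = x +ᵥ supportSet P u := by
  rw [← Set.singleton_vadd, ← Set.singleton_vadd]
  exact (supportSet_add {x} P u).trans (by rw [supportSet_singleton]; rfl)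

theorem supportSet_smul {P : Set E} (hP : IsCompact P) (hne : P.Nonempty) {r : ℝ} (hr : 0 ≤ r)
    (u : E) : supportSet (r • P) u = r • supportSet P u := by
  rcases hr.eq_or_lt with rfl | hr
  · rw [Set.zero_smul_set hne, Set.zero_smul_set (supportSet_nonempty hP hne u)]
    exact supportSet_singleton 0 u
  · ext x
    constructor
    · rintro ⟨⟨y, hy, rfl⟩, h⟩
      refine ⟨y, ⟨hy, fun z hz => ?_⟩, rfl⟩
      have := h (r • z) ⟨z, hz, rfl⟩
      simp only [inner_smul_right] at this
      exact le_of_mul_le_mul_left this hr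
    · rintro ⟨y, hy, rfl⟩
      refine ⟨⟨y, hy.1, rfl⟩, ?_⟩
      rintro _ ⟨z, hz, rfl⟩
      simp only [inner_smul_right]
      exact mul_le_mul_of_nonneg_left (hy.2 z hz) hr.le

/-- If `P ∪ Q` is convex and `h(P, u) < h(Q, u)`, the support set of `P` lies in `Q`: on a segment
from it to the support set of `Q` all points but the first are outside `P`, hence in `Q`. -/
theorem supportSet_subset_of_lt {P Q : Set E} (hQ : IsClosed Q) (hPQ : Convex ℝ (P ∪ Q)) {u : E}
    {x y : E} (hx : x ∈ supportSet P u) (hy : y ∈ Q) (hxy : inner ℝ u x < inner ℝ u y) :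
    supportSet P u ⊆ Q := by
  intro z hz
  have hzx : inner ℝ u z = inner ℝ u x := inner_eq_of_mem_supportSet hz hx
  have hmem : ∀ t : ℝ, t ∈ Set.Ioo (0 : ℝ) 1 → AffineMap.lineMap z y t ∈ Q := by
    rintro t ⟨ht0, ht1⟩
    have h := hPQ (Or.inl hz.1) (Or.inr hy) (by linarith : 0 ≤ 1 - t) ht0.le (by ring)
    rw [← AffineMap.lineMap_apply_module] at h
    refine h.resolve_left fun hP => ?_
    have := hz.2 _ hP
    rw [AffineMap.lineMap_apply_module, inner_add_right, inner_smul_right, inner_smul_right] at this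
    nlinarith
  have hlim : Filter.Tendsto (fun t : ℝ => AffineMap.lineMap z y t) (𝓝[>] (0 : ℝ)) (𝓝 z) := by
    have hc : Continuous (fun t : ℝ => AffineMap.lineMap (k := ℝ) z y t) := by fun_prop
    have := (hc.tendsto 0).mono_left (nhdsWithin_le_nhds (s := Set.Ioi (0 : ℝ)))
    simpa using this
  exact hQ.mem_of_tendsto hlim
    (Filter.mem_of_superset (Ioo_mem_nhdsGT one_pos) hmem)

theorem supportSet_union_of_lt {P Q : Set E} {u x y : E} (hx : x ∈ supportSet P u)
    (hy : y ∈ supportSet Q u) (hxy : inner ℝ u x < inner ℝ u y) :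
    supportSet (P ∪ Q) u = supportSet Q u := by
  ext z
  constructor
  · rintro ⟨hz | hz, h⟩
    · linarith [h y (Or.inr hy.1), hx.2 z hz]
    · exact ⟨hz, fun w hw => h w (Or.inr hw)⟩
  · intro hz
    refine ⟨Or.inr hz.1, ?_⟩
    have := inner_eq_of_mem_supportSet hz hy
    rintro w (hw | hw)
    · linarith [hx.2 w hw]
    · exact hz.2 w hw

theorem supportSet_inter_of_lt {P Q : Set E} (hQ : IsClosed Q) (hPQ : Convex ℝ (P ∪ Q)) {u : E}
    {x y : E} (hx : x ∈ supportSet P u) (hy : y ∈ supportSet Q u)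
    (hxy : inner ℝ u x < inner ℝ u y) : supportSet (P ∩ Q) u = supportSet P u := by
  have hsub := supportSet_subset_of_lt hQ hPQ hx hy.1 hxy
  ext z
  constructor
  · rintro ⟨hz, h⟩
    refine ⟨hz.1, fun w hw => ?_⟩
    exact (hx.2 w hw).trans (h x ⟨hx.1, hsub hx⟩)
  · intro hz
    exact ⟨⟨hz.1, hsub hz⟩, fun w hw => hz.2 w hw.1⟩

theorem supportSet_union_of_eq {P Q : Set E} {u x y : E} (hx : x ∈ supportSet P u)
    (hy : y ∈ supportSet Q u) (hxy : inner ℝ u x = inner ℝ u y) :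
    supportSet (P ∪ Q) u = supportSet P u ∪ supportSet Q u := by
  ext z
  constructor
  · rintro ⟨hz | hz, h⟩
    · exact Or.inl ⟨hz, fun w hw => h w (Or.inl hw)⟩
    · exact Or.inr ⟨hz, fun w hw => h w (Or.inr hw)⟩
  · rintro (hz | hz)
    · refine ⟨Or.inl hz.1, ?_⟩
      have := inner_eq_of_mem_supportSet hz hx
      rintro w (hw | hw)
      · exact hz.2 w hw
      · linarith [hy.2 w hw]
    · refine ⟨Or.inr hz.1, ?_⟩
      have := inner_eq_of_mem_supportSet hz hy
      rintro w (hw | hw)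
      · linarith [hx.2 w hw]
      · exact hz.2 w hw

theorem supportSet_inter_of_eq {P Q : Set E} (hP : IsCompact P) (hQ : IsCompact Q)
    (hPQ : Convex ℝ (P ∪ Q)) {u : E} {x y : E} (hx : x ∈ supportSet P u) (hy : y ∈ supportSet Q u)
    (hxy : inner ℝ u x = inner ℝ u y) :
    supportSet (P ∩ Q) u = supportSet P u ∩ supportSet Q u := by
  -- The segment from `x` to `y` is connected, so that it meets `P ∩ Q`.
  obtain ⟨w, hw, hwP, hwQ⟩ : (segment ℝ x y ∩ (P ∩ Q)).Nonempty := by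
    refine isPreconnected_closed_iff.1 (convex_segment x y).isPreconnected P Q hP.isClosed
      hQ.isClosed (hPQ.segment_subset (Or.inl hx.1) (Or.inr hy.1))
      ⟨x, left_mem_segment ℝ x y, hx.1⟩ ⟨y, right_mem_segment ℝ x y, hy.1⟩
  have hwx : inner ℝ u w = inner ℝ u x := by
    obtain ⟨a, b, -, -, hab, rfl⟩ := hw
    rw [inner_add_right, inner_smul_right, inner_smul_right, ← hxy, ← add_mul, hab, one_mul]
  ext z
  constructor
  · rintro ⟨hz, h⟩
    have hwz := h w ⟨hwP, hwQ⟩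
    exact ⟨⟨hz.1, fun v hv => by linarith [hx.2 v hv]⟩,
      ⟨hz.2, fun v hv => by linarith [hy.2 v hv]⟩⟩
  · rintro ⟨hzP, hzQ⟩
    exact ⟨⟨hzP.1, hzQ.1⟩, fun v hv => hzP.2 v hv.1⟩

/-- For a fixed direction, taking support sets turns a union `P ∪ Q` that is convex and the
intersection `P ∩ Q` into two sets with the same total measure as those of `P` and `Q`. -/
theorem measureReal_supportSet_union_add_inter [MeasurableSpace E] [BorelSpace E]
    (μ : MeasureTheory.Measure E) {P Q : Set E} (hP : IsCompact P) (hQ : IsCompact Q)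
    (hPne : P.Nonempty) (hQne : Q.Nonempty) (hPQ : Convex ℝ (P ∪ Q)) (u : E)
    (hPμ : μ (supportSet P u) ≠ ⊤) (hQμ : μ (supportSet Q u) ≠ ⊤) :
    μ.real (supportSet (P ∪ Q) u) + μ.real (supportSet (P ∩ Q) u) =
      μ.real (supportSet P u) + μ.real (supportSet Q u) := by
  obtain ⟨x, hx⟩ := supportSet_nonempty hP hPne u
  obtain ⟨y, hy⟩ := supportSet_nonempty hQ hQne u
  rcases lt_trichotomy (inner ℝ u x : ℝ) (inner ℝ u y) with h | h | h
  · rw [supportSet_union_of_lt hx hy h, supportSet_inter_of_lt hQ.isClosed hPQ hx hy h, add_comm]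
  · rw [supportSet_union_of_eq hx hy h, supportSet_inter_of_eq hP hQ hPQ hx hy h]
    exact MeasureTheory.measureReal_union_add_inter
      (((isExposed_supportSet Q u).isCompact hQ).isClosed.measurableSet) hPμ hQμ
  · rw [Set.union_comm, Set.inter_comm, supportSet_union_of_lt hy hx h,
      supportSet_inter_of_lt hP.isClosed (by rwa [Set.union_comm]) hy hx h]

end SupportSet

section Faces

open Module

variable {d : ℕ}

theorem IsPolytope.isCompact {P : Set (Euc d)} (hP : IsPolytope P) : IsCompact P := by
  obtain ⟨s, -, rfl⟩ := hP
  exact s.finite_toSet.isCompact_convexHull ℝ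

theorem IsPolytope.convex {P : Set (Euc d)} (hP : IsPolytope P) : Convex ℝ P := by
  obtain ⟨s, -, rfl⟩ := hP
  exact convex_convexHull ℝ _

theorem IsPolytope.nonempty {P : Set (Euc d)} (hP : IsPolytope P) : P.Nonempty := by
  obtain ⟨s, hs, rfl⟩ := hP
  exact hs.to_set.convexHull

theorem IsPolytope.finite_exposed {P : Set (Euc d)} (hP : IsPolytope P) :
    {F : Set (Euc d) | F.Nonempty ∧ IsExposed ℝ P F}.Finite := by
  refine ((Set.finite_Iic d).biUnion fun k _ => polytopeFaces_finite k hP).subset ?_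
  rintro F ⟨hne, hF⟩
  refine Set.mem_biUnion (x := finrank ℝ (vectorSpan ℝ F)) ?_ ⟨hne, hF, rfl⟩
  simpa using Submodule.finrank_le (vectorSpan ℝ F)

theorem eq_supportSet_of_vectorSpan {P F : Set (Euc d)} (hF : IsExposed ℝ P F) (hne : F.Nonempty)
    {u : Euc d} (hFu : F ⊆ supportSet P u)
    (h : vectorSpan ℝ (supportSet P u) ≤ vectorSpan ℝ F) : F = supportSet P u := by
  refine hFu.antisymm fun y hy => ?_
  obtain ⟨l, hl⟩ := hF hne
  obtain ⟨x, hx⟩ := hne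
  have hker : vectorSpan ℝ F ≤ LinearMap.ker (l : Euc d →ₗ[ℝ] ℝ) := by
    rw [vectorSpan_def, Submodule.span_le]
    rintro _ ⟨a, ha, b, hb, rfl⟩
    rw [hl] at ha hb
    have := le_antisymm (hb.2 a ha.1) (ha.2 b hb.1)
    simp [this]
  have hyx : l (y -ᵥ x) = 0 := hker (h (vsub_mem_vectorSpan ℝ hy (hFu hx)))
  rw [vsub_eq_sub, map_sub, sub_eq_zero] at hyx
  rw [hl] at hx ⊢
  exact ⟨hy.1, fun z hz => hyx ▸ hx.2 z hz⟩

theorem subset_supportSet_of_mem_sphericalNormal {P F : Set (Euc d)} (hF : F ⊆ P) {u : Euc d}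
    (hu : u ∈ sphericalNormal P F) : F ⊆ supportSet P u :=
  fun x hx => ⟨hF hx, hu.2 x hx⟩

theorem sphericalNormal_subset {P F : Set (Euc d)} (hF : F ⊆ P) :
    sphericalNormal P F ⊆ ((vectorSpan ℝ F)ᗮ : Submodule ℝ (Euc d)) ∩ Metric.sphere 0 1 := by
  intro u hu
  refine ⟨mem_orthogonal_vectorSpan fun x hx y hy => ?_, by simpa using hu.1⟩
  exact le_antisymm (hu.2 y hy x (hF hx)) (hu.2 x hx y (hF hy))

theorem isClosed_sphericalNormal (P F : Set (Euc d)) : IsClosed (sphericalNormal P F) := by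
  have : sphericalNormal P F =
      {u | ‖u‖ = 1} ∩ ⋂ x ∈ F, ⋂ y ∈ P, {u | inner ℝ u y ≤ inner ℝ u x} := by
    ext u
    simp [sphericalNormal]
  rw [this]
  refine (isClosed_eq continuous_norm continuous_const).inter ?_
  exact isClosed_biInter fun x _ => isClosed_biInter fun y _ =>
    isClosed_le (by fun_prop) (by fun_prop)

theorem finrank_orthogonal_eq {M : Submodule ℝ (Euc d)} {j : ℕ} (hM : finrank ℝ M = j)
    (hjd : j < d) : finrank ℝ Mᗮ = d - j - 1 + 1 := by
  have := M.finrank_add_finrank_orthogonal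
  rw [finrank_euclideanSpace_fin] at this
  omega

theorem measurableSet_unitNormals (M : Submodule ℝ (Euc d)) :
    MeasurableSet ((M : Set (Euc d)) ∩ Metric.sphere 0 1) :=
  (M.closed_of_finiteDimensional.inter Metric.isClosed_sphere).measurableSet

/-- Almost every unit normal vector `u` of `M` is generic: the support set of a polytope in
direction `u` is parallel to a subspace of `M`. -/
theorem ae_vectorSpan_supportSet_le {P : Set (Euc d)} (hP : IsPolytope P)
    {M : Submodule ℝ (Euc d)} {j : ℕ} (hM : finrank ℝ M = j) (hjd : j < d) :
    ∀ᵐ u ∂(μHE[d - j - 1] : MeasureTheory.Measure (Euc d)).restrict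
      ((Mᗮ : Submodule ℝ (Euc d)) ∩ Metric.sphere 0 1),
      vectorSpan ℝ (supportSet P u) ≤ M := by
  rw [MeasureTheory.ae_restrict_iff' (measurableSet_unitNormals Mᗮ), MeasureTheory.ae_iff]
  have hfin := hP.finite_exposed.subset
    (Set.sep_subset {F : Set (Euc d) | F.Nonempty ∧ IsExposed ℝ P F}
      fun F => ¬ vectorSpan ℝ F ≤ M)
  refine MeasureTheory.measure_mono_null (t := ⋃ F ∈ {F ∈ {F : Set (Euc d) | F.Nonempty ∧
    IsExposed ℝ P F} | ¬ vectorSpan ℝ F ≤ M},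
      (((M ⊔ vectorSpan ℝ F)ᗮ : Submodule ℝ (Euc d)) ∩ Metric.sphere 0 1 : Set (Euc d))) ?_ ?_
  · intro u hu
    rw [Set.mem_ofPred_eq, Classical.not_imp] at hu
    obtain ⟨⟨huM, hu1⟩, hu2⟩ := hu
    refine Set.mem_biUnion (x := supportSet P u)
      ⟨⟨supportSet_nonempty hP.isCompact hP.nonempty u, isExposed_supportSet P u⟩, hu2⟩ ⟨?_, hu1⟩
    rw [SetLike.mem_coe, ← Submodule.inf_orthogonal]
    exact ⟨huM, mem_orthogonal_vectorSpan_supportSet P u⟩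
  · rw [MeasureTheory.measure_biUnion_null_iff hfin.countable]
    rintro F ⟨-, hF⟩
    refine euclideanHausdorffMeasure_inter_sphere_eq_zero _ ?_
    have h1 : finrank ℝ M < finrank ℝ (M ⊔ vectorSpan ℝ F : Submodule ℝ (Euc d)) := by
      refine Submodule.finrank_lt_finrank_of_lt (le_sup_left.lt_of_not_ge fun h => hF ?_)
      exact le_sup_right.trans h
    have h2 := (M ⊔ vectorSpan ℝ F).finrank_add_finrank_orthogonal
    rw [finrank_euclideanSpace_fin] at h2
    omega

theorem faceVolume_supportSet_ae_eq {P : Set (Euc d)} (hP : IsPolytope P)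
    {M : Submodule ℝ (Euc d)} {j : ℕ} (hM : finrank ℝ M = j) (hjd : j < d) :
    ∀ᵐ u ∂(μHE[d - j - 1] : MeasureTheory.Measure (Euc d)).restrict
      ((Mᗮ : Submodule ℝ (Euc d)) ∩ Metric.sphere 0 1),
      faceVolume j (supportSet P u) =
        ∑ F ∈ (polytopeFaces_finite j hP).toFinset with vectorSpan ℝ F = M,
          (sphericalNormal P F).indicator (fun _ => faceVolume j F) u := by
  filter_upwards [ae_vectorSpan_supportSet_le hP hM hjd,
    MeasureTheory.ae_restrict_mem (measurableSet_unitNormals Mᗮ)] with u hu hu1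
  have hu1 : ‖u‖ = 1 := by simpa using hu1.2
  rcases hu.eq_or_lt with heq | hlt
  · rw [Finset.sum_eq_single (supportSet P u)]
    · rw [Set.indicator_of_mem]
      exact ⟨hu1, fun x hx => hx.2⟩
    · intro F hF hne
      rw [Finset.mem_filter, Set.Finite.mem_toFinset] at hF
      obtain ⟨⟨hFne, hFexp, -⟩, hFM⟩ := hF
      refine Set.indicator_of_notMem (fun huF => hne ?_) _
      exact eq_supportSet_of_vectorSpan hFexp hFne
        (subset_supportSet_of_mem_sphericalNormal hFexp.subset huF) (by rw [heq, hFM])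
    · intro h
      refine absurd ?_ h
      rw [Finset.mem_filter, Set.Finite.mem_toFinset]
      exact ⟨⟨supportSet_nonempty hP.isCompact hP.nonempty u, isExposed_supportSet P u,
        by rw [heq, hM]⟩, heq⟩
  · rw [Finset.sum_eq_zero]
    · rw [faceVolume, MeasureTheory.measureReal_def,
        euclideanHausdorffMeasure_eq_zero_of_finrank_lt
          (hP.isCompact.isBounded.subset (supportSet_subset P u))
          (hM ▸ Submodule.finrank_lt_finrank_of_lt hlt), ENNReal.toReal_zero]
    · intro F hF
      rw [Finset.mem_filter, Set.Finite.mem_toFinset] at hF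
      obtain ⟨⟨hFne, hFexp, -⟩, hFM⟩ := hF
      refine Set.indicator_of_notMem (fun huF => hlt.not_ge ?_) _
      rw [← hFM]
      exact vectorSpan_mono ℝ (subset_supportSet_of_mem_sphericalNormal hFexp.subset huF)

end Faces

/-! ### Flag valuations -/

section FlagValuation

open Module MeasureTheory

variable {d : ℕ}

/-- The contribution of the direction space `M` to the flag valuation with density `g`: the
integral of `g(u, Mᗮ)` times the `j`-volume of the support set over all unit normals `u` of `M`. -/
noncomputable def flagTerm (j : ℕ) (g : Euc d × Submodule ℝ (Euc d) → ℝ) (P : Set (Euc d))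
    (M : Submodule ℝ (Euc d)) : ℝ :=
  open Classical in
  if finrank ℝ M = j then
    ∫ u in (Mᗮ : Submodule ℝ (Euc d)) ∩ Metric.sphere 0 1,
      g (u, Mᗮ) * faceVolume j (supportSet P u) ∂(μHE[d - j - 1] : Measure (Euc d))
  else 0

/-- The flag valuation with density `g`. Only finitely many direction spaces `M` contribute to its
value on a polytope, those of the `j`-faces. -/
noncomputable def flagValuation (j : ℕ) (g : Euc d × Submodule ℝ (Euc d) → ℝ)
    (P : Set (Euc d)) : ℝ :=
  ∑ᶠ M, flagTerm j g P M

/-- The functional `p ↦ ∫_p g(u, ⟨p⟩) du` on the spherical sets `p` with linear span of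
dimension `q`, extended by zero. -/
noncomputable def sphericalIntegral (q : ℕ) (g : Euc d × Submodule ℝ (Euc d) → ℝ)
    (p : Set (Euc d)) : ℝ :=
  open Classical in
  if finrank ℝ (Submodule.span ℝ p) = q then
    ∫ u in p, g (u, Submodule.span ℝ p) ∂(μHE[q - 1] : Measure (Euc d))
  else 0

theorem sphericalIntegral_eq {q : ℕ} {g : Euc d × Submodule ℝ (Euc d) → ℝ}
    {L : Submodule ℝ (Euc d)} (hL : finrank ℝ L = q) {p : Set (Euc d)} (hp : p ⊆ L)
    (hp1 : p ⊆ Metric.sphere 0 1) :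
    sphericalIntegral q g p = ∫ u in p, g (u, L) ∂(μHE[q - 1] : Measure (Euc d)) := by
  have hle : Submodule.span ℝ p ≤ L := Submodule.span_le.2 hp
  unfold sphericalIntegral
  split_ifs with h
  · rw [Submodule.eq_of_le_of_finrank_eq hle (h.trans hL.symm)]
  · have hlt : finrank ℝ (Submodule.span ℝ p) < q :=
      lt_of_le_of_ne (hL ▸ Submodule.finrank_mono hle) h
    rw [setIntegral_measure_zero]
    exact measure_mono_null (Set.subset_inter Submodule.subset_span hp1)
      (euclideanHausdorffMeasure_inter_sphere_eq_zero _ (by omega))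

theorem integrableOn_unitNormals {L : Submodule ℝ (Euc d)} {n : ℕ} (hL : finrank ℝ L = n + 1)
    {h : Euc d → ℝ} (hh : Continuous h) :
    IntegrableOn h (L ∩ Metric.sphere 0 1) (μHE[n] : Measure (Euc d)) := by
  obtain ⟨C, hC⟩ := (isCompact_sphere (0 : Euc d) 1).exists_bound_of_continuousOn hh.continuousOn
  refine Measure.integrableOn_of_bounded (M := C)
    (euclideanHausdorffMeasure_inter_sphere_lt_top L hL).ne hh.aestronglyMeasurable ?_
  filter_upwards [ae_restrict_mem (measurableSet_unitNormals L)] with u hu using hC u hu.2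

theorem IsSphericalPolytope.measurableSet {p : Set (Euc d)} (hp : IsSphericalPolytope p) :
    MeasurableSet p := by
  obtain ⟨s, rfl⟩ := hp
  refine MeasurableSet.inter ?_ Metric.isClosed_sphere.measurableSet
  have hrange : (PointedCone.hull ℝ (s : Set (Euc d)) : Set (Euc d)) =
      Set.range (fun c : s → NNReal => ∑ i, c i • (i : Euc d)) := by
    ext x
    constructor
    · intro hx
      have hx' : x ∈ Submodule.span NNReal (s : Set (Euc d)) := hx
      obtain ⟨f, hf, rfl⟩ := Submodule.mem_span_finset.1 hx'
      refine ⟨fun i => f i, ?_⟩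
      exact Finset.sum_coe_sort s (fun i => f i • i)
    · rintro ⟨c, rfl⟩
      have h : ∑ i, c i • (i : Euc d) ∈ Submodule.span NNReal (s : Set (Euc d)) :=
        Submodule.sum_mem _ fun i _ => Submodule.smul_mem _ _ (Submodule.subset_span i.2)
      exact h
  rw [hrange]
  have hc : Continuous (fun c : s → NNReal => ∑ i, c i • (i : Euc d)) := by fun_prop
  obtain ⟨K, hK, hKU⟩ := isSigmaCompact_range hc
  rw [← hKU]
  exact MeasurableSet.iUnion fun n => (hK n).isClosed.measurableSet

theorem IsSphericalPolytope.subset_sphere {p : Set (Euc d)} (hp : IsSphericalPolytope p) :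
    p ⊆ Metric.sphere 0 1 := by
  obtain ⟨s, rfl⟩ := hp
  exact Set.inter_subset_right

theorem sphericalIntegral_union_add_inter {q : ℕ} (hq : 1 ≤ q)
    {g : Euc d × Submodule ℝ (Euc d) → ℝ} (hg : ∀ L, Continuous fun u => g (u, L))
    {p p' : Set (Euc d)} (hp' : p' ∈ sphericalPolytopes d q)
    (hpp : p ∪ p' ∈ sphericalPolytopes d q) :
    sphericalIntegral q g (p ∪ p') + sphericalIntegral q g (p ∩ p') =
      sphericalIntegral q g p + sphericalIntegral q g p' := by
  have hzero : ∀ r ⊆ p ∪ p', finrank ℝ (Submodule.span ℝ (p ∪ p')) ≠ q →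
      sphericalIntegral q g r = 0 := by
    intro r hr h
    have h1 := Submodule.finrank_mono (Submodule.span_mono (R := ℝ) hr)
    have h2 := hpp.2
    exact if_neg (by omega)
  by_cases hL : finrank ℝ (Submodule.span ℝ (p ∪ p')) = q
  · have hs := hpp.1.subset_sphere
    have hf : ∀ r ⊆ p ∪ p', sphericalIntegral q g r =
        ∫ u in r, g (u, Submodule.span ℝ (p ∪ p')) ∂(μHE[q - 1] : Measure (Euc d)) :=
      fun r hr => sphericalIntegral_eq hL (hr.trans Submodule.subset_span) (hr.trans hs)
    have hint : IntegrableOn (fun u => g (u, Submodule.span ℝ (p ∪ p'))) (p ∪ p')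
        (μHE[q - 1] : Measure (Euc d)) :=
      (integrableOn_unitNormals (n := q - 1) (by omega) (hg _)).mono_set
        (Set.subset_inter Submodule.subset_span hs)
    rw [hf _ subset_rfl, hf _ (Set.inter_subset_left.trans Set.subset_union_left),
      hf _ Set.subset_union_left, hf _ Set.subset_union_right]
    have hm := hp'.1.measurableSet
    generalize Submodule.span ℝ (p ∪ p') = L at hint ⊢
    rw [← Set.sdiff_union_self, setIntegral_union Set.disjoint_sdiff_left hm
      (hint.mono_set (Set.sdiff_subset.trans Set.subset_union_left))
      (hint.mono_set Set.subset_union_right),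
      ← integral_inter_add_sdiff hm (hint.mono_set Set.subset_union_left)]
    ring
  · rw [hzero _ subset_rfl hL, hzero _ (Set.inter_subset_left.trans Set.subset_union_left) hL,
      hzero _ Set.subset_union_left hL, hzero _ Set.subset_union_right hL]

section

variable {j : ℕ} {g : Euc d × Submodule ℝ (Euc d) → ℝ}

theorem integrableOn_indicator_sphericalNormal (hjd : j < d)
    (hg : ∀ L, Continuous fun u => g (u, L)) {M : Submodule ℝ (Euc d)} (hM : finrank ℝ M = j)
    (P F : Set (Euc d)) :
    IntegrableOn (fun u => g (u, Mᗮ) *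
        (sphericalNormal P F).indicator (fun _ => faceVolume j F) u)
      ((Mᗮ : Submodule ℝ (Euc d)) ∩ Metric.sphere 0 1)
      (μHE[d - j - 1] : Measure (Euc d)) := by
  have h := ((integrableOn_unitNormals (finrank_orthogonal_eq hM hjd) (hg Mᗮ)).integrable.mul_const
    (faceVolume j F)).indicator (isClosed_sphericalNormal P F).measurableSet
  refine h.congr (Filter.Eventually.of_forall fun u => ?_)
  by_cases hu : u ∈ sphericalNormal P F <;> simp [hu]

theorem integrableOn_flagTerm (hjd : j < d) (hg : ∀ L, Continuous fun u => g (u, L))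
    {P : Set (Euc d)} (hP : IsPolytope P) {M : Submodule ℝ (Euc d)} (hM : finrank ℝ M = j) :
    IntegrableOn (fun u => g (u, Mᗮ) * faceVolume j (supportSet P u))
      ((Mᗮ : Submodule ℝ (Euc d)) ∩ Metric.sphere 0 1)
      (μHE[d - j - 1] : Measure (Euc d)) := by
  have h := integrable_finsetSum
    ((polytopeFaces_finite j hP).toFinset.filter fun F => vectorSpan ℝ F = M)
    fun F _ => (integrableOn_indicator_sphericalNormal hjd hg hM P F).integrable
  refine h.congr ?_
  filter_upwards [faceVolume_supportSet_ae_eq hP hM hjd] with u hu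
  rw [hu, Finset.mul_sum]

theorem flagTerm_eq_sum (hjd : j < d) (hg : ∀ L, Continuous fun u => g (u, L))
    {P : Set (Euc d)} (hP : IsPolytope P) (M : Submodule ℝ (Euc d)) :
    flagTerm j g P M = ∑ F ∈ (polytopeFaces_finite j hP).toFinset with vectorSpan ℝ F = M,
      sphericalIntegral (d - j) g (sphericalNormal P F) * faceVolume j F := by
  unfold flagTerm
  split_ifs with hM
  · have hae : (fun u => g (u, Mᗮ) * faceVolume j (supportSet P u))
        =ᵐ[(μHE[d - j - 1] : Measure (Euc d)).restrict
          ((Mᗮ : Submodule ℝ (Euc d)) ∩ Metric.sphere 0 1)]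
        fun u => ∑ F ∈ (polytopeFaces_finite j hP).toFinset with vectorSpan ℝ F = M,
          g (u, Mᗮ) * (sphericalNormal P F).indicator (fun _ => faceVolume j F) u := by
      filter_upwards [faceVolume_supportSet_ae_eq hP hM hjd] with u hu
      rw [hu, Finset.mul_sum]
    rw [integral_congr_ae hae, integral_finsetSum _
      fun F _ => integrableOn_indicator_sphericalNormal hjd hg hM P F]
    refine Finset.sum_congr rfl fun F hF => ?_
    rw [Finset.mem_filter, Set.Finite.mem_toFinset] at hF
    obtain ⟨⟨hFne, hFexp, -⟩, hFM⟩ := hF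
    have hsub := sphericalNormal_subset hFexp.subset
    rw [hFM] at hsub
    have hL : finrank ℝ (Mᗮ : Submodule ℝ (Euc d)) = d - j := by
      have := finrank_orthogonal_eq hM hjd
      omega
    rw [sphericalIntegral_eq hL (hsub.trans Set.inter_subset_left)
      (hsub.trans Set.inter_subset_right), ← integral_mul_const]
    have hind : (fun u => g (u, Mᗮ) *
          (sphericalNormal P F).indicator (fun _ => faceVolume j F) u) =
        (sphericalNormal P F).indicator (fun u => g (u, Mᗮ) * faceVolume j F) := by
      ext u
      by_cases hu : u ∈ sphericalNormal P F <;> simp [hu]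
    rw [hind, setIntegral_indicator (isClosed_sphericalNormal P F).measurableSet,
      Set.inter_eq_right.2 hsub]
  · rw [Finset.sum_eq_zero]
    intro F hF
    rw [Finset.mem_filter, Set.Finite.mem_toFinset] at hF
    exact absurd (hF.2 ▸ hF.1.2.2) hM

theorem flagTerm_support_subset (hjd : j < d) (hg : ∀ L, Continuous fun u => g (u, L))
    {P : Set (Euc d)} (hP : IsPolytope P) :
    Function.support (flagTerm j g P) ⊆ vectorSpan ℝ '' polytopeFaces j P := by
  intro M hM
  rw [Function.mem_support, flagTerm_eq_sum hjd hg hP] at hM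
  obtain ⟨F, hF, -⟩ := Finset.exists_ne_zero_of_sum_ne_zero hM
  rw [Finset.mem_filter, Set.Finite.mem_toFinset] at hF
  exact ⟨F, hF.1, hF.2⟩

theorem flagTerm_support_finite (hjd : j < d) (hg : ∀ L, Continuous fun u => g (u, L))
    {P : Set (Euc d)} (hP : IsPolytope P) : (Function.support (flagTerm j g P)).Finite :=
  ((polytopeFaces_finite j hP).image _).subset (flagTerm_support_subset hjd hg hP)

theorem flagValuation_eq_finsum (hjd : j < d) (hg : ∀ L, Continuous fun u => g (u, L))
    {P : Set (Euc d)} (hP : IsPolytope P) :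
    flagValuation j g P =
      ∑ᶠ F ∈ polytopeFaces j P, sphericalIntegral (d - j) g (sphericalNormal P F) *
        faceVolume j F := by
  classical
  rw [flagValuation, finsum_mem_eq_finite_toFinset_sum _ (polytopeFaces_finite j hP),
    finsum_eq_sum_of_support_subset (s := (polytopeFaces_finite j hP).toFinset.image (vectorSpan ℝ))
      _ (by simpa using flagTerm_support_subset hjd hg hP),
    Finset.sum_congr rfl fun M _ => flagTerm_eq_sum hjd hg hP M]
  exact Finset.sum_fiberwise_of_maps_to (fun F hF => Finset.mem_image_of_mem _ hF) _

theorem flagTerm_union_add_inter (hjd : j < d) (hg : ∀ L, Continuous fun u => g (u, L))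
    {P Q : Set (Euc d)} (hP : IsPolytope P) (hQ : IsPolytope Q) (hPQ : IsPolytope (P ∪ Q))
    (M : Submodule ℝ (Euc d)) :
    flagTerm j g (P ∩ Q) M = flagTerm j g P M + flagTerm j g Q M - flagTerm j g (P ∪ Q) M := by
  unfold flagTerm
  split_ifs with hM
  · have iP := integrableOn_flagTerm hjd hg hP hM
    have iQ := integrableOn_flagTerm hjd hg hQ hM
    have iPQ := integrableOn_flagTerm hjd hg hPQ hM
    have hsum := iP.integrable.add iQ.integrable
    simp only [Pi.add_def] at hsum
    rw [← integral_add iP iQ, ← integral_sub hsum iPQ]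
    refine integral_congr_ae ?_
    have hfin : ∀ {R : Set (Euc d)} {u : Euc d}, IsPolytope R →
        vectorSpan ℝ (supportSet R u) ≤ M →
        (μHE[j] : Measure (Euc d)) (supportSet R u) ≠ ⊤ := fun hR hu =>
      (euclideanHausdorffMeasure_lt_top_of_finrank_le
        (hR.isCompact.isBounded.subset (supportSet_subset _ _))
        (hM ▸ Submodule.finrank_mono hu)).ne
    filter_upwards [ae_vectorSpan_supportSet_le hP hM hjd,
      ae_vectorSpan_supportSet_le hQ hM hjd] with u huP huQ
    have := measureReal_supportSet_union_add_inter (μHE[j] : Measure (Euc d)) hP.isCompact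
      hQ.isCompact hP.nonempty hQ.nonempty hPQ.convex u (hfin hP huP) (hfin hQ huQ)
    simp only [faceVolume]
    linear_combination g (u, Mᗮ) * this
  · simp

theorem isPolytopeValuation_flagValuation (hjd : j < d)
    (hg : ∀ L, Continuous fun u => g (u, L)) :
    IsPolytopeValuation (flagValuation (d := d) j g) := by
  intro P Q hP hQ hPQ
  have sP := flagTerm_support_finite hjd hg hP
  have sQ := flagTerm_support_finite hjd hg hQ
  have sPQ := flagTerm_support_finite hjd hg hPQ
  have : flagValuation j g (P ∩ Q) =
      flagValuation j g P + flagValuation j g Q - flagValuation j g (P ∪ Q) := by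
    unfold flagValuation
    rw [← finsum_add_distrib sP sQ, ← finsum_sub_distrib
      ((sP.union sQ).subset (Function.support_add _ _)) sPQ]
    exact finsum_congr fun M => flagTerm_union_add_inter hjd hg hP hQ hPQ M
  rw [this]
  ring

theorem isTranslationInvariant_flagValuation :
    IsTranslationInvariant (flagValuation (d := d) j g) := by
  intro P _ x
  unfold flagValuation flagTerm
  simp only [supportSet_vadd, faceVolume, measureReal_def, measure_vadd]

theorem faceVolume_smul (hj : 1 ≤ j) {F : Set (Euc d)} (hF : F.Nonempty) {r : ℝ} (hr : 0 ≤ r) :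
    faceVolume j (r • F) = r ^ j * faceVolume j F := by
  rcases hr.eq_or_lt with rfl | hr
  · rw [Set.zero_smul_set hF, zero_pow (by omega), zero_mul, faceVolume, measureReal_def,
      euclideanHausdorffMeasure_eq_zero_of_finrank_lt, ENNReal.toReal_zero]
    · exact (Set.finite_zero).isBounded
    · rw [← Set.singleton_zero, vectorSpan_singleton, finrank_bot]
      omega
  · rw [faceVolume, measureReal_def, Measure.euclideanHausdorffMeasure_smul₀ j hr.ne',
      ENNReal.toReal_smul, faceVolume, measureReal_def, NNReal.smul_def]
    simp [abs_of_pos hr]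

theorem isHomogeneousOfDegree_flagValuation (hj : 1 ≤ j) :
    IsHomogeneousOfDegree j (flagValuation (d := d) j g) := by
  intro P hP r hr
  unfold flagValuation
  rw [← smul_eq_mul, smul_finsum]
  refine finsum_congr fun M => ?_
  unfold flagTerm
  split_ifs with hM
  · rw [smul_eq_mul, ← integral_const_mul]
    congr 1
    ext u
    rw [supportSet_smul hP.isCompact hP.nonempty hr,
      faceVolume_smul hj (supportSet_nonempty hP.isCompact hP.nonempty u) hr]
    ring
  · simp

theorem isFlagContinuous_flagValuation (hjd : j < d) (hg : ∀ L, Continuous fun u => g (u, L))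
    (hg' : ContinuousOn g (flagManifold d (d - j))) :
    IsFlagContinuous j (flagValuation (d := d) j g) := by
  refine ⟨sphericalIntegral (d - j) g, ⟨?_, ?_, ?_⟩, g, hg', ?_⟩
  · intro p _ hlt
    exact if_neg hlt.ne
  · intro p _ q hq hpq
    exact sphericalIntegral_union_add_inter (by omega) hg hq hpq
  · intro P hP
    exact flagValuation_eq_finsum hjd hg hP
  · intro p _ hp
    exact if_pos hp

end

end FlagValuation

/-! ### Support functions, Hausdorff limits and zonotopes -/

section SupportFunction

variable {E : Type*} [NormedAddCommGroup E] [InnerProductSpace ℝ E]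

/-- `h` is the support function of `A`, and the maximum it stands for is attained. -/
def IsSupportFunction (A : Set E) (h : E → ℝ) : Prop :=
  ∀ u, IsGreatest ((fun x => inner ℝ u x) '' A) (h u)

theorem IsSupportFunction.inner_le {A : Set E} {h : E → ℝ} (hA : IsSupportFunction A h) {x : E}
    (hx : x ∈ A) (u : E) : inner ℝ u x ≤ h u :=
  (hA u).2 ⟨x, hx, rfl⟩

theorem IsSupportFunction.exists_eq {A : Set E} {h : E → ℝ} (hA : IsSupportFunction A h) (u : E) :
    ∃ x ∈ A, inner ℝ u x = h u :=
  (hA u).1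

theorem IsSupportFunction.nonempty {A : Set E} {h : E → ℝ} (hA : IsSupportFunction A h) :
    A.Nonempty :=
  (hA.exists_eq 0).imp fun _ h => h.1

theorem IsSupportFunction.mem_supportSet_iff {A : Set E} {h : E → ℝ} (hA : IsSupportFunction A h)
    {u x : E} : x ∈ supportSet A u ↔ x ∈ A ∧ inner ℝ u x = h u := by
  obtain ⟨y, hy, hyu⟩ := hA.exists_eq u
  constructor
  · rintro ⟨hx, hmax⟩
    exact ⟨hx, le_antisymm (hA.inner_le hx u) (hyu ▸ hmax y hy)⟩
  · rintro ⟨hx, hxu⟩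
    exact ⟨hx, fun z hz => hxu ▸ hA.inner_le hz u⟩

theorem IsSupportFunction.add {A B : Set E} {h k : E → ℝ} (hA : IsSupportFunction A h)
    (hB : IsSupportFunction B k) : IsSupportFunction (A + B) (fun u => h u + k u) := by
  intro u
  obtain ⟨x, hx, hxu⟩ := hA.exists_eq u
  obtain ⟨y, hy, hyu⟩ := hB.exists_eq u
  refine ⟨⟨x + y, ⟨x, hx, y, hy, rfl⟩, by simp [inner_add_right, hxu, hyu]⟩, ?_⟩
  rintro _ ⟨_, ⟨a, ha, b, hb, rfl⟩, rfl⟩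
  simp only [inner_add_right]
  exact add_le_add (hA.inner_le ha u) (hB.inner_le hb u)

theorem IsSupportFunction.convexHull {A : Set E} {h : E → ℝ} (hA : IsSupportFunction A h) :
    IsSupportFunction (convexHull ℝ A) h := by
  intro u
  obtain ⟨x, hx, hxu⟩ := hA.exists_eq u
  refine ⟨⟨x, subset_convexHull ℝ A hx, hxu⟩, ?_⟩
  rintro _ ⟨y, hy, rfl⟩
  have hconv : Convex ℝ {y : E | inner ℝ u y ≤ h u} :=
    convex_halfSpace_le (𝕜 := ℝ) (innerSL ℝ u).toLinearMap.isLinear (h u)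
  exact convexHull_min (fun z hz => hA.inner_le hz u) hconv hy

theorem IsSupportFunction.union {A B : Set E} {h k : E → ℝ} (hA : IsSupportFunction A h)
    (hB : IsSupportFunction B k) : IsSupportFunction (A ∪ B) (fun u => max (h u) (k u)) := by
  intro u
  rw [Set.image_union]
  exact (hA u).union (hB u)

/-- Adjoining points below the supporting hyperplane does not change the support set. -/
theorem supportSet_convexHull_union {A B : Set E} {h k : E → ℝ} (hA : IsSupportFunction A h)
    (hB : IsSupportFunction B k) (hconv : Convex ℝ A) {u : E} (hlt : k u < h u) :
    supportSet (convexHull ℝ (A ∪ B)) u = supportSet A u := by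
  ext x
  rw [(hA.union hB).convexHull.mem_supportSet_iff, hA.mem_supportSet_iff, max_eq_left hlt.le]
  constructor
  · rintro ⟨hx, hxu⟩
    refine ⟨?_, hxu⟩
    rw [convexHull_union hA.nonempty hB.nonempty, mem_convexJoin, hconv.convexHull_eq] at hx
    obtain ⟨a, ha, b, hb, s, t, hs, ht, hst, rfl⟩ := hx
    have h1 := hA.inner_le ha u
    have h2 := hB.convexHull.inner_le hb u
    rw [inner_add_right, inner_smul_right, inner_smul_right] at hxu
    have ht0 : t = 0 := by
      by_contra ht0
      have : 0 < t := lt_of_le_of_ne ht (Ne.symm ht0)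
      obtain rfl : s = 1 - t := by linarith
      nlinarith
    have hs1 : s = 1 := by linarith
    simpa [ht0, hs1] using ha
  · rintro ⟨hx, hxu⟩
    exact ⟨subset_convexHull ℝ _ (Or.inl hx), hxu⟩

theorem exists_dist_le_of_supportFunction_le {A B : Set E} {h k : E → ℝ}
    (hA : IsSupportFunction A h) (hB : IsSupportFunction B k) (hBc : IsCompact B)
    (hBconv : Convex ℝ B) {ε : ℝ} (hε : ∀ u, ‖u‖ = 1 → h u ≤ k u + ε) (hε0 : 0 ≤ ε) {x : E}
    (hx : x ∈ A) : ∃ y ∈ B, dist x y ≤ ε := by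
  obtain ⟨y, hy, hmin⟩ := exists_norm_eq_iInf_of_complete_convex hB.nonempty hBc.isComplete
    hBconv x
  rw [norm_eq_iInf_iff_real_inner_le_zero hBconv hy] at hmin
  refine ⟨y, hy, ?_⟩
  rcases eq_or_ne x y with rfl | hne
  · simpa using hε0
  have hpos : 0 < ‖x - y‖ := norm_pos_iff.2 (sub_ne_zero.2 hne)
  set u : E := ‖x - y‖⁻¹ • (x - y) with hu
  have hu1 : ‖u‖ = 1 := by rw [hu, norm_smul, norm_inv, norm_norm, inv_mul_cancel₀ hpos.ne']
  have hky : k u ≤ inner ℝ u y := by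
    obtain ⟨w, hw, hwu⟩ := hB.exists_eq u
    have := hmin w hw
    rw [← hwu, ← sub_nonpos, ← inner_sub_right, hu, inner_smul_left]
    exact mul_nonpos_of_nonneg_of_nonpos (by simp) this
  have hux : inner ℝ u x - inner ℝ u y = ‖x - y‖ := by
    rw [← inner_sub_right, hu, inner_smul_left, real_inner_self_eq_norm_sq]
    simp only [map_inv₀, conj_trivial]
    field_simp
  rw [dist_eq_norm]
  linarith [hA.inner_le hx u, hε u hu1]

theorem hausdorffDist_le_of_supportFunction {A B : Set E} {h k : E → ℝ}
    (hA : IsSupportFunction A h) (hB : IsSupportFunction B k) (hAc : IsCompact A)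
    (hBc : IsCompact B) (hAconv : Convex ℝ A) (hBconv : Convex ℝ B) {ε : ℝ} (hε0 : 0 ≤ ε)
    (hε : ∀ u, ‖u‖ = 1 → |h u - k u| ≤ ε) : Metric.hausdorffDist A B ≤ ε := by
  refine Metric.hausdorffDist_le_of_mem_dist hε0 (fun x hx => ?_) fun x hx => ?_
  · exact exists_dist_le_of_supportFunction_le hA hB hBc hBconv
      (fun u hu => by linarith [(abs_le.1 (hε u hu)).2]) hε0 hx
  · exact exists_dist_le_of_supportFunction_le hB hA hAc hAconv
      (fun u hu => by linarith [(abs_le.1 (hε u hu)).1]) hε0 hx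

end SupportFunction

section Limits

open TopologicalSpace Filter

variable {E : Type*} [NormedAddCommGroup E] [InnerProductSpace ℝ E]

/-- A convex body as an element of the complete space of non-empty compact sets. -/
def ConvexBody.toNonemptyCompacts (K : ConvexBody E) : NonemptyCompacts E :=
  ⟨⟨K, K.isCompact⟩, K.nonempty⟩

theorem NonemptyCompacts.convex_of_tendsto {P : ℕ → ConvexBody E} {K : NonemptyCompacts E}
    (h : Tendsto (fun n => (P n).toNonemptyCompacts) atTop (𝓝 K)) : Convex ℝ (K : Set E) := by
  intro x hx y hy a b ha hb hab
  have hcl : IsClosed (K : Set E) := K.isCompact.isClosed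
  rw [← hcl.closure_eq, Metric.mem_closure_iff]
  intro ε hε
  obtain ⟨n, hn⟩ := ((Metric.tendsto_nhds.1 h) (ε / 2) (half_pos hε)).exists
  rw [Metric.NonemptyCompacts.dist_eq] at hn
  have hfin : Metric.hausdorffEDist ((P n).toNonemptyCompacts : Set E) (K : Set E) ≠ ⊤ :=
    Metric.hausdorffEDist_ne_top_of_nonempty_of_bounded (P n).nonempty K.nonempty
      (P n).isCompact.isBounded K.isCompact.isBounded
  obtain ⟨x', hx', hxx⟩ := Metric.exists_dist_lt_of_hausdorffDist_lt' hx hn hfin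
  obtain ⟨y', hy', hyy⟩ := Metric.exists_dist_lt_of_hausdorffDist_lt' hy hn hfin
  have hz : a • x' + b • y' ∈ ((P n).toNonemptyCompacts : Set E) :=
    (P n).convex hx' hy' ha hb hab
  obtain ⟨w, hw, hzw⟩ := Metric.exists_dist_lt_of_hausdorffDist_lt hz hn hfin
  refine ⟨w, hw, ?_⟩
  have h1 : dist (a • x + b • y) (a • x' + b • y') ≤ ε / 2 := by
    rw [dist_comm]
    refine (dist_add_add_le _ _ _ _).trans ?_
    rw [dist_smul₀, dist_smul₀, Real.norm_of_nonneg ha, Real.norm_of_nonneg hb]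
    nlinarith
  linarith [dist_triangle (a • x + b • y) (a • x' + b • y') w]

/-- Two sequences of convex bodies whose support functions converge to the same function,
uniformly on the unit sphere, have a common Hausdorff limit. -/
theorem exists_tendsto_of_supportFunction [CompleteSpace E] {P Q : ℕ → ConvexBody E}
    {p q : ℕ → E → ℝ} (hP : ∀ n, IsSupportFunction (P n : Set E) (p n))
    (hQ : ∀ n, IsSupportFunction (Q n : Set E) (q n)) {G : E → ℝ} {ε : ℕ → ℝ} (hanti : Antitone ε)
    (hε : Tendsto ε atTop (𝓝 0)) (hpG : ∀ n u, ‖u‖ = 1 → |p n u - G u| ≤ ε n)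
    (hqG : ∀ n u, ‖u‖ = 1 → |q n u - G u| ≤ ε n) :
    ∃ K : ConvexBody E, Tendsto P atTop (𝓝 K) ∧ Tendsto Q atTop (𝓝 K) := by
  have hε0 : ∀ n, 0 ≤ ε n := fun n => hanti.le_of_tendsto hε n
  have hd : ∀ {A B : ConvexBody E} {a b : E → ℝ} {n m : ℕ}, IsSupportFunction (A : Set E) a →
      IsSupportFunction (B : Set E) b → (∀ u, ‖u‖ = 1 → |a u - G u| ≤ ε n) →
      (∀ u, ‖u‖ = 1 → |b u - G u| ≤ ε m) →
      Metric.hausdorffDist (A : Set E) B ≤ ε n + ε m := by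
    intro A B a b n m hA hB ha hb
    refine hausdorffDist_le_of_supportFunction hA hB A.isCompact B.isCompact A.convex B.convex
      (add_nonneg (hε0 n) (hε0 m)) fun u hu => ?_
    have h1 := abs_le.1 (ha u hu)
    have h2 := abs_le.1 (hb u hu)
    exact abs_le.2 ⟨by linarith, by linarith⟩
  have hcauchy : CauchySeq fun n => (P n).toNonemptyCompacts := by
    refine cauchySeq_of_le_tendsto_0 (fun n => 2 * ε n) (fun n m N hn hm => ?_)
      (by simpa using hε.const_mul 2)
    rw [Metric.NonemptyCompacts.dist_eq]
    have := hd (hP n) (hP m) (hpG n) (hpG m)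
    exact this.trans (by linarith [hanti hn, hanti hm])
  obtain ⟨K, hK⟩ := cauchySeq_tendsto_of_complete hcauchy
  have hPK : Tendsto P atTop (𝓝 ⟨K, NonemptyCompacts.convex_of_tendsto hK, K.isCompact,
      K.nonempty⟩) := by
    rw [tendsto_iff_dist_tendsto_zero] at hK ⊢
    exact hK
  refine ⟨_, hPK, ?_⟩
  rw [tendsto_iff_dist_tendsto_zero] at hPK ⊢
  refine squeeze_zero (fun _ => dist_nonneg) (fun n => dist_triangle (Q n) (P n) _) ?_
  have h2 : Tendsto (fun n => dist (Q n) (P n)) atTop (𝓝 0) :=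
    squeeze_zero (fun _ => dist_nonneg) (fun n => hd (hQ n) (hP n) (hqG n) (hpG n))
      (by simpa using hε.add hε)
  simpa using h2.add hPK

end Limits

section Zonotope

variable {E : Type*} [NormedAddCommGroup E] [InnerProductSpace ℝ E]
variable {ι : Type*} [Fintype ι]

/-- The centred zonotope generated by the segments `[-v i, v i]`. -/
def zonotope (v : ι → E) : Set E :=
  (fun t : ι → ℝ => ∑ i, t i • v i) '' Set.Icc (-1) 1

theorem isSupportFunction_zonotope (v : ι → E) :
    IsSupportFunction (zonotope v) fun u => ∑ i, |inner ℝ u (v i)| := by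
  intro u
  constructor
  · refine ⟨_, ⟨fun i => SignType.sign (inner ℝ u (v i) : ℝ), ?_, rfl⟩, ?_⟩
    · constructor <;> intro i
      · rcases lt_trichotomy (inner ℝ u (v i) : ℝ) 0 with h | h | h <;> simp [h]
      · rcases lt_trichotomy (inner ℝ u (v i) : ℝ) 0 with h | h | h <;> simp [h]
    · simp only [inner_sum, inner_smul_right]
      exact Finset.sum_congr rfl fun i _ => sign_mul_self _
  · rintro _ ⟨_, ⟨t, ht, rfl⟩, rfl⟩
    simp only [inner_sum, inner_smul_right]
    refine Finset.sum_le_sum fun i _ => ?_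
    refine (le_abs_self _).trans ?_
    rw [abs_mul]
    exact mul_le_of_le_one_left (abs_nonneg _) (abs_le.2 ⟨ht.1 i, ht.2 i⟩)

theorem mem_supportSet_zonotope {v : ι → E} {u x : E} : x ∈ supportSet (zonotope v) u ↔
    ∃ t ∈ Set.Icc (-1 : ι → ℝ) 1, (∀ i, t i * inner ℝ u (v i) = |inner ℝ u (v i)|) ∧
      ∑ i, t i • v i = x := by
  rw [(isSupportFunction_zonotope v).mem_supportSet_iff]
  constructor
  · rintro ⟨⟨t, ht, rfl⟩, h⟩
    refine ⟨t, ht, fun i => ?_, rfl⟩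
    simp only [inner_sum, inner_smul_right] at h
    have hle : ∀ i ∈ Finset.univ, t i * inner ℝ u (v i) ≤ |inner ℝ u (v i)| := fun i _ => by
      refine (le_abs_self _).trans ?_
      rw [abs_mul]
      exact mul_le_of_le_one_left (abs_nonneg _) (abs_le.2 ⟨ht.1 i, ht.2 i⟩)
    exact (Finset.sum_eq_sum_iff_of_le hle).1 h i (Finset.mem_univ i)
  · rintro ⟨t, ht, h, rfl⟩
    refine ⟨⟨t, ht, rfl⟩, ?_⟩
    simp only [inner_sum, inner_smul_right]
    exact Finset.sum_congr rfl fun i _ => h i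

theorem eq_sign_of_mul_eq_abs {t a : ℝ} (h : t * a = |a|) (ha : a ≠ 0) :
    t = SignType.sign a := by
  refine mul_right_cancel₀ ha ?_
  rw [h, sign_mul_self]

theorem sign_mem_Icc (a : ℝ) : (-1 : ℝ) ≤ SignType.sign a ∧ (SignType.sign a : ℝ) ≤ 1 := by
  rcases lt_trichotomy a 0 with h | h | h <;> simp [h]

theorem supportSet_zonotope_of_orthogonal {v : ι → E} {u : E} (h : ∀ i, inner ℝ u (v i) = 0) :
    supportSet (zonotope v) u = zonotope v := by
  refine (supportSet_subset _ _).antisymm ?_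
  rintro _ ⟨t, ht, rfl⟩
  exact mem_supportSet_zonotope.2 ⟨t, ht, fun i => by simp [h], rfl⟩

theorem supportSet_zonotope_of_forall_ne {v : ι → E} {u : E} (h : ∀ i, inner ℝ u (v i) ≠ 0) :
    supportSet (zonotope v) u = {∑ i, (SignType.sign (inner ℝ u (v i) : ℝ) : ℝ) • v i} := by
  ext x
  rw [mem_supportSet_zonotope, Set.mem_singleton_iff]
  constructor
  · rintro ⟨t, -, ht, rfl⟩
    exact Finset.sum_congr rfl fun i _ => by rw [eq_sign_of_mul_eq_abs (ht i) (h i)]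
  · rintro rfl
    exact ⟨_, ⟨fun i => (sign_mem_Icc _).1, fun i => (sign_mem_Icc _).2⟩,
      fun i => sign_mul_self _, rfl⟩

theorem sum_sign_smul_add_smul_mem_supportSet {v : ι → E} {u : E} {p : ι}
    (hp : inner ℝ u (v p) = 0) {s : ℝ} (hs : s ∈ Set.Icc (-1 : ℝ) 1) :
    (∑ i, (SignType.sign (inner ℝ u (v i) : ℝ) : ℝ) • v i) + s • v p ∈
      supportSet (zonotope v) u := by
  classical
  refine mem_supportSet_zonotope.2
    ⟨fun i => SignType.sign (inner ℝ u (v i) : ℝ) + if i = p then s else 0,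
    ⟨fun i => ?_, fun i => ?_⟩, fun i => ?_, ?_⟩
  · by_cases hi : i = p
    · simpa [hi, hp] using hs.1
    · simpa [hi] using (sign_mem_Icc (inner ℝ u (v i))).1
  · by_cases hi : i = p
    · simpa [hi, hp] using hs.2
    · simpa [hi] using (sign_mem_Icc (inner ℝ u (v i))).2
  · by_cases hi : i = p
    · simp [hi, hp]
    · simp [hi, sign_mul_self]
  · simp [add_smul, Finset.sum_add_distrib]

theorem supportSet_zonotope_of_unique {v : ι → E} {u : E} {p : ι}
    (hp : inner ℝ u (v p) = 0) (h : ∀ i, i ≠ p → inner ℝ u (v i) ≠ 0) :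
    supportSet (zonotope v) u = (∑ i, (SignType.sign (inner ℝ u (v i) : ℝ) : ℝ) • v i) +ᵥ
      ((fun s : ℝ => s • v p) '' Set.Icc (-1) 1) := by
  classical
  ext x
  constructor
  · rw [mem_supportSet_zonotope]
    rintro ⟨t, ht, htu, rfl⟩
    refine ⟨t p • v p, ⟨t p, ⟨ht.1 p, ht.2 p⟩, rfl⟩, ?_⟩
    change _ + t p • v p = _
    rw [← Finset.add_sum_erase _ _ (Finset.mem_univ p),
      ← Finset.add_sum_erase (a := p) _ (fun i => t i • v i) (Finset.mem_univ p), hp]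
    simp only [sign_zero, SignType.coe_zero, zero_smul, zero_add]
    rw [add_comm]
    congr 1
    refine Finset.sum_congr rfl fun i hi => ?_
    rw [eq_sign_of_mul_eq_abs (htu i) (h i (Finset.ne_of_mem_erase hi))]
  · rintro ⟨_, ⟨s, hs, rfl⟩, rfl⟩
    exact sum_sign_smul_add_smul_mem_supportSet hp hs

theorem mem_vectorSpan_supportSet_zonotope {v : ι → E} {u : E} {p : ι}
    (hp : inner ℝ u (v p) = 0) : v p ∈ vectorSpan ℝ (supportSet (zonotope v) u) := by
  have := vsub_mem_vectorSpan ℝ (sum_sign_smul_add_smul_mem_supportSet hp (s := 1) (by simp))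
    (sum_sign_smul_add_smul_mem_supportSet hp (s := 0) (by simp))
  simpa using this

theorem convex_zonotope (v : ι → E) : Convex ℝ (zonotope v) := by
  have h : IsLinearMap ℝ (fun t : ι → ℝ => ∑ i, t i • v i) :=
    ⟨fun x y => by simp [add_smul, Finset.sum_add_distrib],
      fun r x => by simp [Finset.smul_sum, mul_smul]⟩
  exact (convex_Icc (-1 : ι → ℝ) 1).is_linear_image h

theorem zonotope_cons {n : ℕ} (a : E) (v : Fin n → E) :
    zonotope (Fin.cons a v : Fin (n + 1) → E) =
      ((fun s : ℝ => s • a) '' Set.Icc (-1) 1) + zonotope v := by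
  ext x
  constructor
  · rintro ⟨t, ht, rfl⟩
    refine ⟨t 0 • a, ⟨t 0, ⟨ht.1 0, ht.2 0⟩, rfl⟩, _,
      ⟨fun i => t i.succ, ⟨fun i => ht.1 i.succ, fun i => ht.2 i.succ⟩, rfl⟩, ?_⟩
    simp [Fin.sum_univ_succ]
  · rintro ⟨_, ⟨s, hs, rfl⟩, _, ⟨t, ht, rfl⟩, rfl⟩
    refine ⟨Fin.cons s t, ⟨fun i => ?_, fun i => ?_⟩, by simp [Fin.sum_univ_succ]⟩
    · refine Fin.cases ?_ (fun i => ?_) i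
      · simpa using hs.1
      · simpa using ht.1 i
    · refine Fin.cases ?_ (fun i => ?_) i
      · simpa using hs.2
      · simpa using ht.2 i

theorem vectorSpan_le_of_subset_vadd {M : Submodule ℝ E} {x : E} {s : Set E}
    (h : s ⊆ x +ᵥ (M : Set E)) : vectorSpan ℝ s ≤ M := by
  rw [vectorSpan_def, Submodule.span_le]
  rintro _ ⟨a, ha, b, hb, rfl⟩
  obtain ⟨a', ha', rfl⟩ := h ha
  obtain ⟨b', hb', rfl⟩ := h hb
  simpa using M.sub_mem ha' hb'

theorem zonotope_subset_span (v : ι → E) :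
    zonotope v ⊆ (Submodule.span ℝ (Set.range v) : Set E) := by
  rintro _ ⟨t, -, rfl⟩
  exact Submodule.sum_mem _ fun i _ =>
    Submodule.smul_mem _ _ (Submodule.subset_span (Set.mem_range_self i))

theorem vectorSpan_le_vectorSpan_add_left {A B : Set E} (hB : B.Nonempty) :
    vectorSpan ℝ A ≤ vectorSpan ℝ (A + B) := by
  obtain ⟨b, hb⟩ := hB
  rw [vectorSpan_def, Submodule.span_le]
  rintro _ ⟨x, hx, y, hy, rfl⟩
  have := vsub_mem_vectorSpan ℝ (s := A + B) ⟨x, hx, b, hb, rfl⟩ ⟨y, hy, b, hb, rfl⟩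
  simpa using this

theorem vectorSpan_le_vectorSpan_add_right {A B : Set E} (hA : A.Nonempty) :
    vectorSpan ℝ B ≤ vectorSpan ℝ (A + B) := by
  rw [add_comm]
  exact vectorSpan_le_vectorSpan_add_left hA

/-- A zonotope with orthogonal generators is a box. -/
theorem euclideanHausdorffMeasure_zonotope_smul [MeasurableSpace E] [BorelSpace E] {k : ℕ}
    {m : Fin k → E} (hm : Orthonormal ℝ m) {l : Fin k → ℝ} (hl : ∀ i, 0 ≤ l i) :
    (μHE[k] : MeasureTheory.Measure E) (zonotope fun i => l i • m i) =
      ENNReal.ofReal (∏ i, (2 * l i)) := by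
  rw [← euclideanHausdorffMeasure_orthonormal_box hm hl]
  congr 1
  ext x
  constructor
  · rintro ⟨t, ht, rfl⟩
    refine ⟨fun i => t i * l i, ⟨fun i => ?_, fun i => ?_⟩, by simp [mul_smul]⟩
    · have := ht.1 i
      simp only [Pi.neg_apply, Pi.one_apply] at this ⊢
      nlinarith [hl i]
    · have := ht.2 i
      simp only [Pi.one_apply] at this ⊢
      nlinarith [hl i]
  · rintro ⟨t, ht, rfl⟩
    have hb : ∀ i, |t i| ≤ l i := fun i => abs_le.2 ⟨ht.1 i, ht.2 i⟩
    have h1 : ∀ i, |t i / l i| ≤ 1 := fun i => by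
      rw [abs_div, abs_of_nonneg (hl i)]
      exact div_le_one_of_le₀ (hb i) (hl i)
    refine ⟨fun i => t i / l i, ⟨fun i => (abs_le.1 (h1 i)).1, fun i => (abs_le.1 (h1 i)).2⟩, ?_⟩
    refine Finset.sum_congr rfl fun i _ => ?_
    rw [smul_smul]
    rcases (hl i).eq_or_lt with h0 | h0
    · have : t i = 0 := abs_nonpos_iff.1 (by rw [h0]; exact hb i)
      simp [this]
    · rw [div_mul_cancel₀ _ h0.ne']

end Zonotope

section Polytopes

variable {d : ℕ}

theorem isPolytope_convexHull {s : Set (Euc d)} (hs : s.Finite) (hne : s.Nonempty) :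
    IsPolytope (convexHull ℝ s) :=
  ⟨hs.toFinset, by simpa using hne, by simp⟩

theorem IsPolytope.add {P Q : Set (Euc d)} (hP : IsPolytope P) (hQ : IsPolytope Q) :
    IsPolytope (P + Q) := by
  obtain ⟨s, hs, rfl⟩ := hP
  obtain ⟨t, ht, rfl⟩ := hQ
  rw [← convexHull_add]
  exact isPolytope_convexHull (s.finite_toSet.add t.finite_toSet) (hs.to_set.add ht.to_set)

theorem IsPolytope.convexHull_union {P Q : Set (Euc d)} (hP : IsPolytope P) (hQ : IsPolytope Q) :
    IsPolytope (convexHull ℝ (P ∪ Q)) := by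
  obtain ⟨s, hs, rfl⟩ := hP
  obtain ⟨t, ht, rfl⟩ := hQ
  rw [convexHull_convexHull_union_left, convexHull_convexHull_union_right]
  exact isPolytope_convexHull (s.finite_toSet.union t.finite_toSet) (hs.to_set.inl)

theorem isPolytope_zonotope {ι : Type*} [Fintype ι] (v : ι → Euc d) : IsPolytope (zonotope v) := by
  let f : (ι → ℝ) →ₗ[ℝ] Euc d :=
    { toFun := fun t => ∑ i, t i • v i
      map_add' := fun x y => by simp [add_smul, Finset.sum_add_distrib]
      map_smul' := fun r x => by simp [Finset.smul_sum, mul_smul] }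
  have hcube : Set.Icc (-1 : ι → ℝ) 1 =
      convexHull ℝ (Set.univ.pi fun _ : ι => ({-1, 1} : Set ℝ)) := by
    rw [convexHull_pi, ← Set.pi_univ_Icc]
    simp [convexHull_pair, segment_eq_Icc]
  have : zonotope v = convexHull ℝ (f '' Set.univ.pi fun _ : ι => ({-1, 1} : Set ℝ)) := by
    rw [← f.image_convexHull, ← hcube]
    rfl
  rw [this]
  exact isPolytope_convexHull ((Set.Finite.pi fun _ => Set.toFinite _).image f)
    ((Set.univ_pi_nonempty_iff.2 fun _ => ⟨1, by simp⟩).image f)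

/-- A polytope as a convex body. -/
def IsPolytope.toConvexBody {P : Set (Euc d)} (hP : IsPolytope P) : ConvexBody (Euc d) :=
  ⟨P, hP.convex, hP.isCompact, hP.nonempty⟩

end Polytopes

/-! ### Support functions of the approximating zonotopes -/

section RiemannSum

/-- The midpoint of the `i`-th of `N` intervals of equal length that make up `[-1, 1]`. -/
noncomputable def gridNode (N i : ℕ) : ℝ := (2 * i + 1) / N - 1

theorem abs_gridNode_le {N i : ℕ} (hi : i < N) : |gridNode N i| ≤ 1 := by
  have hN : (0 : ℝ) < N := by exact_mod_cast Nat.zero_lt_of_lt hi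
  have hi' : (i : ℝ) + 1 ≤ N := by exact_mod_cast hi
  have h0 : (0 : ℝ) ≤ i := Nat.cast_nonneg i
  rw [gridNode, abs_le]
  constructor
  · have : 0 ≤ (2 * (i : ℝ) + 1) / N := by positivity
    linarith
  · rw [sub_le_iff_le_add, div_le_iff₀ hN]
    linarith

theorem abs_mul_abs_sub_le {x h : ℝ} (hh : 0 ≤ h) :
    |(x + h) * |x + h| - (x - h) * |x - h| - 4 * h * (|x|)| ≤ 2 * h ^ 2 := by
  rcases abs_cases (x + h) with ⟨h1, h1'⟩ | ⟨h1, h1'⟩ <;>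
  rcases abs_cases (x - h) with ⟨h2, h2'⟩ | ⟨h2, h2'⟩ <;>
  rcases abs_cases x with ⟨h3, h3'⟩ | ⟨h3, h3'⟩ <;>
  rw [h1, h2, h3, abs_le] <;> constructor <;> nlinarith

theorem abs_mean_gridNode_sub_le {N : ℕ} (hN : 0 < N) {a z : ℝ} (haz : |a| ≤ |z|) :
    |(∑ i ∈ Finset.range N, |a + gridNode N i * z|) / N - (a ^ 2 + z ^ 2) / (2 * |z|)| ≤
      |z| / (2 * N) := by
  wlog hz : 0 ≤ z generalizing a z
  · have := this (a := -a) (z := -z) (by simpa using haz) (by linarith)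
    have hflip : ∀ i, |-a + gridNode N i * -z| = |a + gridNode N i * z| := fun i => by
      rw [← abs_neg]
      congr 1
      ring
    simpa only [abs_neg, neg_sq, hflip] using this
  have hN' : (0 : ℝ) < N := by exact_mod_cast hN
  rcases hz.eq_or_lt with rfl | hz
  · have : a = 0 := by simpa using haz
    simp [this]
  rw [abs_of_pos hz] at haz ⊢
  obtain ⟨ha1, ha2⟩ := abs_le.1 haz
  -- Telescope with the primitive `x * |x|` of `2 * |x|`.
  set f : ℕ → ℝ := fun i => (a + (2 * i / N - 1) * z) * |a + (2 * i / N - 1) * z| with hf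
  have htel : ∑ i ∈ Finset.range N, (f (i + 1) - f i) = 2 * a ^ 2 + 2 * z ^ 2 := by
    rw [Finset.sum_range_sub, hf]
    have h1 : (2 * (N : ℝ) / N - 1) = 1 := by field_simp; norm_num
    simp only [h1, Nat.cast_zero, mul_zero, zero_div]
    rw [abs_of_nonneg (by linarith), abs_of_nonpos (by linarith)]
    ring
  have hstep : ∀ i ∈ Finset.range N,
      |(f (i + 1) - f i) - 4 * (z / N) * (|a + gridNode N i * z|)| ≤ 2 * (z / N) ^ 2 := by
    intro i _
    have h := abs_mul_abs_sub_le (x := a + gridNode N i * z) (h := z / N) (by positivity)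
    have h1 : a + gridNode N i * z + z / N = a + (2 * ((i + 1 : ℕ) : ℝ) / N - 1) * z := by
      rw [gridNode]; push_cast; ring
    have h2 : a + gridNode N i * z - z / N = a + (2 * (i : ℝ) / N - 1) * z := by
      rw [gridNode]; ring
    rw [h1, h2] at h
    exact h
  have hsum := (Finset.abs_sum_le_sum_abs _ _).trans (Finset.sum_le_sum hstep)
  rw [Finset.sum_sub_distrib, htel, ← Finset.mul_sum, Finset.sum_const, Finset.card_range,
    nsmul_eq_mul] at hsum
  have hz4 : (0 : ℝ) < 4 * z := by linarith
  rw [abs_sub_comm, ← mul_le_mul_iff_right₀ hz4, ← abs_of_pos hz4, ← abs_mul, abs_of_pos hz4]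
  have e1 : 4 * z * ((a ^ 2 + z ^ 2) / (2 * z) -
      (∑ i ∈ Finset.range N, |a + gridNode N i * z|) / N) = 2 * a ^ 2 + 2 * z ^ 2 -
      4 * (z / N) * ∑ i ∈ Finset.range N, |a + gridNode N i * z| := by
    field_simp
    ring
  have e2 : 4 * z * (z / (2 * N)) = N * (2 * (z / N) ^ 2) := by
    field_simp
    ring
  rw [e1, e2]
  exact hsum

/-- In coordinates, the support function of the zonotope generated by the vectors
`(c, s, b) / N` and `(-s, c, b) / N`, with `b` running through the `N` grid nodes. -/
noncomputable def gridSupport (c s : ℝ) (N : ℕ) (x y z : ℝ) : ℝ :=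
  (∑ i ∈ Finset.range N, |(c * x + s * y) + gridNode N i * z|) / N +
    (∑ i ∈ Finset.range N, |(-s * x + c * y) + gridNode N i * z|) / N

/-- The limit of `gridSupport c s N` on the cone `x² + y² ≤ z²`. It does not depend on the
rotation `(c, s)`. -/
noncomputable def paraboloidSupport (x y z : ℝ) : ℝ :=
  open Classical in
  if x ^ 2 + y ^ 2 ≤ z ^ 2 then (x ^ 2 + y ^ 2 + 2 * z ^ 2) / (2 * |z|) else 0

theorem abs_gridSupport_sub_le {c s : ℝ} (hcs : c ^ 2 + s ^ 2 = 1) {N : ℕ} (hN : 0 < N)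
    {x y z : ℝ} (h : x ^ 2 + y ^ 2 ≤ z ^ 2) :
    |gridSupport c s N x y z - paraboloidSupport x y z| ≤ |z| / N := by
  have h1 : |c * x + s * y| ≤ |z| := by
    rw [← sq_le_sq]
    nlinarith [sq_nonneg (s * x - c * y)]
  have h2 : |-s * x + c * y| ≤ |z| := by
    rw [← sq_le_sq]
    nlinarith [sq_nonneg (c * x + s * y)]
  have h3 := abs_le.1 (abs_mean_gridNode_sub_le hN h1)
  have h4 := abs_le.1 (abs_mean_gridNode_sub_le hN h2)
  rw [paraboloidSupport, if_pos h]
  have e : (x ^ 2 + y ^ 2 + 2 * z ^ 2) / (2 * |z|) =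
      ((c * x + s * y) ^ 2 + z ^ 2) / (2 * |z|) + ((-s * x + c * y) ^ 2 + z ^ 2) / (2 * |z|) := by
    rw [← add_div]
    congr 1
    linear_combination (-(x ^ 2) - y ^ 2) * hcs
  have e2 : |z| / N = |z| / (2 * N) + |z| / (2 * N) := by
    have hN' : (0 : ℝ) < N := by exact_mod_cast hN
    field_simp
    norm_num
  rw [e, e2, gridSupport, abs_le]
  constructor <;> linarith

theorem gridSupport_le {c s : ℝ} (hcs : c ^ 2 + s ^ 2 = 1) (N : ℕ) (x y z : ℝ) :
    gridSupport c s N x y z ≤ 2 * (|x| + |y|) + 2 * |z| := by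
  have hc : |c| ≤ 1 := by
    rw [← abs_one, ← sq_le_sq]; nlinarith [sq_nonneg s]
  have hs : |s| ≤ 1 := by
    rw [← abs_one, ← sq_le_sq]; nlinarith [sq_nonneg c]
  have key : ∀ p q : ℝ, |p| ≤ 1 → |q| ≤ 1 →
      (∑ i ∈ Finset.range N, |(p * x + q * y) + gridNode N i * z|) / N ≤ |x| + |y| + |z| := by
    intro p q hp hq
    refine div_le_of_le_mul₀ (by positivity) (by positivity) ?_
    calc _ ≤ ∑ i ∈ Finset.range N, (|x| + |y| + |z|) := by
          refine Finset.sum_le_sum fun i hi => ?_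
          have hi := abs_gridNode_le (Finset.mem_range.1 hi)
          refine (abs_add_le _ _).trans (add_le_add ((abs_add_le _ _).trans ?_) ?_)
          · rw [abs_mul, abs_mul]
            gcongr
            · exact mul_le_of_le_one_left (abs_nonneg _) hp
            · exact mul_le_of_le_one_left (abs_nonneg _) hq
          · rw [abs_mul]
            exact mul_le_of_le_one_left (abs_nonneg _) hi
      _ = _ := by rw [Finset.sum_const, Finset.card_range, nsmul_eq_mul, mul_comm]
  rw [gridSupport]
  linarith [key c s hc hs, key (-s) c (by simpa using hs) hc]

/-- After taking the maximum with `4 (|x| + |y|)`, which dominates outside the cone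
`x² + y² ≤ z²`, the support functions converge everywhere. -/
theorem abs_max_gridSupport_sub_le {c s : ℝ} (hcs : c ^ 2 + s ^ 2 = 1) {N : ℕ} (hN : 0 < N)
    (x y z : ℝ) :
    |max (gridSupport c s N x y z) (4 * (|x| + |y|)) -
      max (paraboloidSupport x y z) (4 * (|x| + |y|))| ≤ |z| / N := by
  by_cases h : x ^ 2 + y ^ 2 ≤ z ^ 2
  · exact (abs_max_sub_max_le_abs _ _ _).trans (abs_gridSupport_sub_le hcs hN h)
  · have hz : |z| ≤ |x| + |y| := by
      refine abs_le_of_sq_le_sq' (a := |z|) ?_ (by positivity) |>.2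
      rw [sq_abs]
      nlinarith [sq_abs x, sq_abs y, mul_nonneg (abs_nonneg x) (abs_nonneg y)]
    rw [max_eq_right (by linarith [gridSupport_le hcs N x y z]), max_eq_right, sub_self, abs_zero]
    · positivity
    · rw [paraboloidSupport, if_neg h]
      positivity

theorem lt_gridSupport {c s : ℝ} (hcs : c ^ 2 + s ^ 2 = 1) {N : ℕ} (hN : 2 ≤ N) {x y z : ℝ}
    (h : x ^ 2 + y ^ 2 + z ^ 2 ≤ 1) (hz : 999 / 1000 < -z) :
    4 * (|x| + |y|) < gridSupport c s N x y z := by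
  have hxy : x ^ 2 + y ^ 2 ≤ 1 / 500 := by nlinarith
  have h1 := abs_le.1 (abs_gridSupport_sub_le hcs (by omega : 0 < N)
    (by nlinarith : x ^ 2 + y ^ 2 ≤ z ^ 2))
  rw [paraboloidSupport, if_pos (by nlinarith), abs_of_neg (by linarith)] at h1
  have h2 : -z ≤ (x ^ 2 + y ^ 2 + 2 * z ^ 2) / (2 * -z) := by
    rw [le_div_iff₀ (by linarith)]
    nlinarith [sq_nonneg x, sq_nonneg y]
  have h3 : -z / N ≤ -z / 2 := by
    have : (2 : ℝ) ≤ N := by exact_mod_cast hN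
    exact div_le_div_of_nonneg_left (by linarith) (by norm_num) this
  have h4 : |x| + |y| ≤ 1 / 10 := by
    refine abs_le_of_sq_le_sq' ?_ (by norm_num) |>.2
    nlinarith [sq_abs x, sq_abs y, sq_nonneg (|x| - |y|)]
  linarith [h1.1]

end RiemannSum

/-! ### The density and the generators -/

section Density

open Module MeasureTheory

variable {d n : ℕ}

/-- A function on the sphere supported in a small cap around `-e₂`. -/
noncomputable def capDensity (e : Fin 3 ⊕ Fin n → Euc d) (u : Euc d) : ℝ :=
  max 0 (-inner ℝ u (e (.inl 2)) - 999 / 1000)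

/-- A function of a subspace `L`, equal to `1` if `L` is orthogonal to all `e (.inr k)` and to `0`
if it contains one of them. -/
noncomputable def productDensity (e : Fin 3 ⊕ Fin n → Euc d) (L : Submodule ℝ (Euc d)) : ℝ :=
  max 0 (1 - ∑ k, ‖L.starProjection (e (.inr k))‖ ^ 2)

/-- The square of the entry `(0, 1)` of the matrix of the orthogonal projection to `L`. For
`L = Mᗮ` it is also that of the orthogonal projection to `M`. -/
noncomputable def directionDensity (e : Fin 3 ⊕ Fin n → Euc d) (L : Submodule ℝ (Euc d)) : ℝ :=
  (inner ℝ (L.starProjection (e (.inl 0))) (e (.inl 1))) ^ 2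

/-- The density of the flag valuation that is not continuous. -/
noncomputable def flagDensity (e : Fin 3 ⊕ Fin n → Euc d) (x : Euc d × Submodule ℝ (Euc d)) : ℝ :=
  capDensity e x.1 * (productDensity e x.2 * directionDensity e x.2)

theorem continuous_starProjection_apply (v : Euc d) :
    Continuous fun L : Submodule ℝ (Euc d) => L.starProjection v := by
  have h : Continuous fun L : Submodule ℝ (Euc d) => L.starProjection := continuous_induced_dom
  exact h.clm_apply continuous_const

theorem continuous_capDensity (e : Fin 3 ⊕ Fin n → Euc d) : Continuous (capDensity e) := by
  unfold capDensity
  fun_prop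

theorem continuous_flagDensity (e : Fin 3 ⊕ Fin n → Euc d) : Continuous (flagDensity e) := by
  have h1 : Continuous (productDensity e) :=
    continuous_const.max (continuous_const.sub (continuous_finsetSum _ fun k _ =>
      (continuous_starProjection_apply _).norm.pow 2))
  have h2 : Continuous (directionDensity e) :=
    ((continuous_starProjection_apply _).inner continuous_const).pow 2
  exact ((continuous_capDensity e).comp continuous_fst).mul
    ((h1.comp continuous_snd).mul (h2.comp continuous_snd))

theorem capDensity_nonneg (e : Fin 3 ⊕ Fin n → Euc d) (u : Euc d) : 0 ≤ capDensity e u :=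
  le_max_left _ _

theorem lt_of_capDensity_ne_zero {e : Fin 3 ⊕ Fin n → Euc d} {u : Euc d}
    (h : capDensity e u ≠ 0) : 999 / 1000 < -inner ℝ u (e (.inl 2)) := by
  by_contra hle
  exact h (max_eq_left (by linarith))

theorem productDensity_eq_zero {e : Fin 3 ⊕ Fin n → Euc d} (he : Orthonormal ℝ e)
    {L : Submodule ℝ (Euc d)} {k : Fin n} (hk : e (.inr k) ∈ L) : productDensity e L = 0 := by
  refine max_eq_left ?_
  have h1 : ‖L.starProjection (e (.inr k))‖ ^ 2 = 1 := by
    rw [Submodule.starProjection_eq_self_iff.2 hk, he.norm_eq_one, one_pow]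
  have h2 := Finset.single_le_sum (f := fun k => ‖L.starProjection (e (.inr k))‖ ^ 2)
    (fun i _ => sq_nonneg _) (Finset.mem_univ k)
  simp only [h1] at h2
  linarith

theorem mem_orthogonal_span_range {ι : Type*} {f : ι → Euc d} {w : Euc d} :
    w ∈ (Submodule.span ℝ (Set.range f))ᗮ ↔ ∀ i, inner ℝ (f i) w = 0 := by
  constructor
  · intro h i
    exact h _ (Submodule.subset_span (Set.mem_range_self i))
  · intro h y hy
    induction hy using Submodule.span_induction with
    | mem y hy => obtain ⟨i, rfl⟩ := hy; exact h i
    | zero => simp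
    | add a b _ _ ha hb => rw [inner_add_left, ha, hb, add_zero]
    | smul c a _ ha => rw [inner_smul_left, ha, mul_zero]

end Density

section Bodies

open Module MeasureTheory

variable {d n : ℕ}

/-- The generator of the zonotopes with horizontal part `(c, s)` or `(-s, c)`, depending on the
Boolean, and height `b`. -/
noncomputable def generator (e : Fin 3 ⊕ Fin n → Euc d) (c s b : ℝ) (t : Bool) : Euc d :=
  (if t then c else -s) • e (.inl 0) + (if t then s else c) • e (.inl 1) + b • e (.inl 2)

theorem inner_generator (e : Fin 3 ⊕ Fin n → Euc d) (c s b : ℝ) (t : Bool) (u : Euc d) :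
    inner ℝ u (generator e c s b t) = (if t then c else -s) * inner ℝ u (e (.inl 0)) +
      (if t then s else c) * inner ℝ u (e (.inl 1)) + b * inner ℝ u (e (.inl 2)) := by
  simp only [generator, inner_add_right, inner_smul_right]

section

variable {e : Fin 3 ⊕ Fin n → Euc d} (he : Orthonormal ℝ e) (c s b : ℝ) (t : Bool)
include he

theorem inner_zero_generator :
    inner ℝ (e (.inl 0)) (generator e c s b t) = if t then c else -s := by
  simp [inner_generator, orthonormal_iff_ite.1 he, he.norm_eq_one]

theorem inner_one_generator :
    inner ℝ (e (.inl 1)) (generator e c s b t) = if t then s else c := by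
  simp [inner_generator, orthonormal_iff_ite.1 he, he.norm_eq_one]

theorem inner_two_generator : inner ℝ (e (.inl 2)) (generator e c s b t) = b := by
  simp [inner_generator, orthonormal_iff_ite.1 he, he.norm_eq_one]

theorem inner_inr_generator (k : Fin n) :
    inner ℝ (e (.inr k)) (generator e c s b t) = 0 := by
  simp [inner_generator, orthonormal_iff_ite.1 he]

theorem norm_sq_generator (hcs : c ^ 2 + s ^ 2 = 1) : ‖generator e c s b t‖ ^ 2 = 1 + b ^ 2 := by
  rw [← real_inner_self_eq_norm_sq, inner_generator, real_inner_comm, inner_zero_generator he,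
    real_inner_comm, inner_one_generator he, real_inner_comm, inner_two_generator he]
  cases t <;> simp <;> linear_combination hcs

end

/-- The linear span of a generator and the vectors `e (.inr k)`. -/
noncomputable def generatorSpan (e : Fin 3 ⊕ Fin n → Euc d) (c s b : ℝ) (t : Bool) :
    Submodule ℝ (Euc d) :=
  Submodule.span ℝ (Set.range (Fin.cons (generator e c s b t) fun k => e (.inr k) :
    Fin (n + 1) → Euc d))

theorem mem_orthogonal_generatorSpan {e : Fin 3 ⊕ Fin n → Euc d} {c s b : ℝ} {t : Bool}
    {w : Euc d} : w ∈ (generatorSpan e c s b t)ᗮ ↔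
      inner ℝ (generator e c s b t) w = 0 ∧ ∀ k, inner ℝ (e (.inr k)) w = 0 := by
  rw [generatorSpan, mem_orthogonal_span_range, Fin.forall_fin_succ]
  simp

theorem generator_mem_generatorSpan (e : Fin 3 ⊕ Fin n → Euc d) (c s b : ℝ) (t : Bool) :
    generator e c s b t ∈ generatorSpan e c s b t :=
  Submodule.subset_span ⟨0, by simp⟩

theorem inr_mem_generatorSpan (e : Fin 3 ⊕ Fin n → Euc d) (c s b : ℝ) (t : Bool) (k : Fin n) :
    e (.inr k) ∈ generatorSpan e c s b t :=
  Submodule.subset_span ⟨k.succ, by simp⟩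

theorem generatorSpan_le {e : Fin 3 ⊕ Fin n → Euc d} {c s b : ℝ} {t : Bool}
    {M : Submodule ℝ (Euc d)} (h : generator e c s b t ∈ M) (h' : ∀ k, e (.inr k) ∈ M) :
    generatorSpan e c s b t ≤ M := by
  rw [generatorSpan, Submodule.span_le]
  rintro _ ⟨k, rfl⟩
  refine Fin.cases ?_ (fun k => ?_) k
  · simpa using h
  · simpa using h' k

section

variable {e : Fin 3 ⊕ Fin n → Euc d} (he : Orthonormal ℝ e) {c s : ℝ} (hcs : c ^ 2 + s ^ 2 = 1)
include he hcs

theorem norm_generator_pos (b : ℝ) (t : Bool) : 0 < ‖generator e c s b t‖ := by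
  have h := norm_sq_generator he c s b t hcs
  have h0 := norm_nonneg (generator e c s b t)
  refine lt_of_le_of_ne h0 fun h1 => ?_
  rw [← h1] at h
  nlinarith [sq_nonneg b]

theorem orthonormal_cons_generator (b : ℝ) (t : Bool) :
    Orthonormal ℝ (Fin.cons (‖generator e c s b t‖⁻¹ • generator e c s b t)
      fun k => e (.inr k) : Fin (n + 1) → Euc d) := by
  have hpos := norm_generator_pos he hcs b t
  have hinr : ∀ k, inner ℝ (generator e c s b t) (e (.inr k)) = 0 := fun k => by
    rw [real_inner_comm, inner_inr_generator he]
  constructor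
  · intro k
    refine Fin.cases ?_ (fun k => ?_) k
    · simp [norm_smul, hpos.ne']
    · simp [he.norm_eq_one]
  · intro k l hkl
    revert hkl
    refine Fin.cases ?_ (fun k => ?_) k <;> refine Fin.cases ?_ (fun l => ?_) l
    · simp
    · simp [inner_smul_left, hinr]
    · simp [inner_smul_right, inner_inr_generator he]
    · intro hkl
      simp only [Fin.cons_succ]
      refine he.inner_eq_zero fun h => hkl ?_
      rw [Sum.inr.inj h]

theorem finrank_generatorSpan (b : ℝ) (t : Bool) :
    finrank ℝ (generatorSpan e c s b t) = n + 1 := by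
  have ho := orthonormal_cons_generator he hcs b t
  have hspan : Submodule.span ℝ (Set.range (Fin.cons
      (‖generator e c s b t‖⁻¹ • generator e c s b t) fun k => e (.inr k) :
        Fin (n + 1) → Euc d)) ≤ generatorSpan e c s b t := by
    rw [Submodule.span_le]
    rintro _ ⟨k, rfl⟩
    refine Fin.cases ?_ (fun k => ?_) k
    · simpa using Submodule.smul_mem _ _ (generator_mem_generatorSpan e c s b t)
    · simpa using inr_mem_generatorSpan e c s b t k
  refine le_antisymm ((finrank_range_le_card _).trans (by simp)) ?_
  have h := finrank_span_eq_card ho.linearIndependent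
  rw [Fintype.card_fin] at h
  rw [← h]
  exact Submodule.finrank_mono hspan

omit he hcs in
theorem productDensity_generatorSpan (b : ℝ) (t : Bool) :
    productDensity e (generatorSpan e c s b t)ᗮ = 1 := by
  have h : ∀ k, (generatorSpan e c s b t)ᗮ.starProjection (e (.inr k)) = 0 := fun k => by
    rw [Submodule.starProjection_apply_eq_zero_iff]
    exact Submodule.le_orthogonal_orthogonal _ (inr_mem_generatorSpan e c s b t k)
  simp [productDensity, h]

theorem directionDensity_generatorSpan (b : ℝ) (t : Bool) :
    directionDensity e (generatorSpan e c s b t)ᗮ = (c * s / (1 + b ^ 2)) ^ 2 := by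
  have hns := norm_sq_generator he c s b t hcs
  rw [← real_inner_self_eq_norm_sq] at hns
  have hb : (1 + b ^ 2) ≠ 0 := by positivity
  set r : ℝ := (if t then c else -s) / (1 + b ^ 2) with hr
  have h : (generatorSpan e c s b t)ᗮ.starProjection (e (.inl 0)) =
      e (.inl 0) - r • generator e c s b t := by
    refine Submodule.eq_starProjection_of_mem_of_inner_eq_zero ?_ fun w hw => ?_
    · rw [mem_orthogonal_generatorSpan]
      refine ⟨?_, fun k => ?_⟩
      · rw [inner_sub_right, inner_smul_right, hns, real_inner_comm, inner_zero_generator he, hr]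
        field_simp
        simp
      · rw [inner_sub_right, inner_smul_right, inner_inr_generator he,
          he.inner_eq_zero (by simp)]
        simp
    · rw [mem_orthogonal_generatorSpan] at hw
      rw [sub_sub_cancel, inner_smul_left, hw.1, mul_zero]
  rw [directionDensity, h, inner_sub_left, he.inner_eq_zero (by simp), inner_smul_left,
    real_inner_comm, inner_one_generator he, hr]
  cases t <;> simp <;> ring

/-- The spaces spanned by different generators are different. -/
theorem eq_of_generator_mem_generatorSpan {b b' : ℝ} {t t' : Bool}
    (h : generator e c s b' t' ∈ generatorSpan e c s b t) : b' = b ∧ t' = t := by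
  obtain ⟨a, ha⟩ : ∃ a : ℝ, ∀ r : Fin 3, inner ℝ (e (.inl r)) (generator e c s b' t') =
      a * inner ℝ (e (.inl r)) (generator e c s b t) := by
    rw [generatorSpan, Fin.range_cons, Submodule.mem_span_insert] at h
    obtain ⟨a, z, hz, heq⟩ := h
    refine ⟨a, fun r => ?_⟩
    have hr : inner ℝ z (e (.inl r)) = 0 := by
      refine (mem_orthogonal_span_range.2 fun k => ?_ : e (.inl r) ∈ _) z hz
      exact he.inner_eq_zero (by simp)
    rw [heq, inner_add_right, inner_smul_right, real_inner_comm z, hr, add_zero]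
  have h0 := ha 0
  have h1 := ha 1
  have h2 := ha 2
  rw [inner_zero_generator he, inner_zero_generator he] at h0
  rw [inner_one_generator he, inner_one_generator he] at h1
  rw [inner_two_generator he, inner_two_generator he] at h2
  cases t <;> cases t' <;> simp only [if_true, if_false, Bool.false_eq_true] at h0 h1 <;>
    simp only [reduceCtorEq, and_true, and_false]
  · have : a = 1 := by linear_combination (1 - a) * hcs - c * h1 + s * h0
    rw [h2, this, one_mul]
  · exact one_ne_zero (by linear_combination c * h0 + s * h1 - hcs : (1 : ℝ) = 0)
  · exact one_ne_zero (by linear_combination -s * h0 + c * h1 - hcs : (1 : ℝ) = 0)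
  · have : a = 1 := by linear_combination (1 - a) * hcs - c * h0 - s * h1
    rw [h2, this, one_mul]

end

end Bodies

/-! ### The flag valuation of the approximating polytopes -/

section Evaluation

open Module MeasureTheory

variable {d n : ℕ}

/-- The zonotope whose support function is `gridSupport` in the coordinates given by `e`. -/
noncomputable def gridZonotope (e : Fin 3 ⊕ Fin n → Euc d) (c s : ℝ) (N : ℕ) : Set (Euc d) :=
  zonotope fun p : Fin N × Bool => (1 / N : ℝ) • generator e c s (gridNode N p.1) p.2

/-- The approximating polytopes: the convex hull of the zonotope `gridZonotope` and a square in a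
horizontal plane, which hides the dependence of the limit on the rotation `(c, s)`, times a cube
of dimension `n`. -/
noncomputable def gridBody (e : Fin 3 ⊕ Fin n → Euc d) (c s : ℝ) (N : ℕ) : Set (Euc d) :=
  convexHull ℝ (gridZonotope e c s N ∪
    zonotope ![(4 : ℝ) • e (.inl 0), (4 : ℝ) • e (.inl 1)]) + zonotope fun k => e (.inr k)

theorem isPolytope_gridBody (e : Fin 3 ⊕ Fin n → Euc d) (c s : ℝ) (N : ℕ) :
    IsPolytope (gridBody e c s N) :=
  ((isPolytope_zonotope _).convexHull_union (isPolytope_zonotope _)).add (isPolytope_zonotope _)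

theorem isSupportFunction_gridZonotope (e : Fin 3 ⊕ Fin n → Euc d) (c s : ℝ) (N : ℕ) :
    IsSupportFunction (gridZonotope e c s N) fun u =>
      gridSupport c s N (inner ℝ u (e (.inl 0))) (inner ℝ u (e (.inl 1)))
        (inner ℝ u (e (.inl 2))) := by
  have h := isSupportFunction_zonotope
    fun p : Fin N × Bool => (1 / N : ℝ) • generator e c s (gridNode N p.1) p.2
  rw [gridZonotope]
  convert h using 2 with u
  rw [Fintype.sum_prod_type]
  simp only [Fintype.sum_bool, inner_smul_right, inner_generator, if_true, Bool.false_eq_true,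
    if_false, abs_mul]
  rw [Finset.sum_add_distrib, ← Finset.mul_sum, ← Finset.mul_sum, gridSupport,
    Finset.sum_range, Finset.sum_range, abs_of_nonneg (by positivity : (0 : ℝ) ≤ 1 / N)]
  ring

theorem isSupportFunction_square (e : Fin 3 ⊕ Fin n → Euc d) :
    IsSupportFunction (zonotope ![(4 : ℝ) • e (.inl 0), (4 : ℝ) • e (.inl 1)]) fun u =>
      4 * (|inner ℝ u (e (.inl 0))| + |inner ℝ u (e (.inl 1))|) := by
  convert isSupportFunction_zonotope ![(4 : ℝ) • e (.inl 0), (4 : ℝ) • e (.inl 1)] using 2 with u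
  simp [Fin.sum_univ_two, inner_smul_right, abs_mul]
  ring

theorem isSupportFunction_gridBody (e : Fin 3 ⊕ Fin n → Euc d) (c s : ℝ) (N : ℕ) :
    IsSupportFunction (gridBody e c s N) fun u =>
      max (gridSupport c s N (inner ℝ u (e (.inl 0))) (inner ℝ u (e (.inl 1)))
        (inner ℝ u (e (.inl 2)))) (4 * (|inner ℝ u (e (.inl 0))| + |inner ℝ u (e (.inl 1))|)) +
        ∑ k, |inner ℝ u (e (.inr k))| :=
  ((isSupportFunction_gridZonotope e c s N).union (isSupportFunction_square e)).convexHull.add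
    (isSupportFunction_zonotope _)

theorem gridNode_injective {N i i' : ℕ} (hN : 0 < N) (h : gridNode N i = gridNode N i') :
    i = i' := by
  have hN' : (N : ℝ) ≠ 0 := by exact_mod_cast hN.ne'
  rw [gridNode, gridNode, sub_left_inj, div_left_inj' hN'] at h
  have : (i : ℝ) = i' := by linarith
  exact_mod_cast this

section

variable {e : Fin 3 ⊕ Fin n → Euc d} (he : Orthonormal ℝ e)
include he

theorem sum_sq_inner_inl_le (u : Euc d) (hu : ‖u‖ = 1) :
    inner ℝ u (e (.inl 0)) ^ 2 + inner ℝ u (e (.inl 1)) ^ 2 + inner ℝ u (e (.inl 2)) ^ 2 ≤ 1 := by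
  have h := (he.comp _ Sum.inl_injective).sum_inner_products_le (s := Finset.univ) (x := u)
  rw [hu, Fin.sum_univ_three] at h
  simpa [real_inner_comm] using h

variable {c s : ℝ} (hcs : c ^ 2 + s ^ 2 = 1)
include hcs

/-- In the cap, the square does not affect the support sets. -/
theorem supportSet_gridBody {N : ℕ} (hN : 2 ≤ N) {u : Euc d} (hu : ‖u‖ = 1)
    (hcap : capDensity e u ≠ 0) :
    supportSet (gridBody e c s N) u =
      supportSet (gridZonotope e c s N) u + supportSet (zonotope fun k => e (.inr k)) u := by
  rw [gridBody, supportSet_add, supportSet_convexHull_union (isSupportFunction_gridZonotope e c s N)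
    (isSupportFunction_square e) (convex_zonotope _)]
  exact lt_gridSupport hcs hN (sum_sq_inner_inl_le he u hu) (lt_of_capDensity_ne_zero hcap)

/-- The only direction spaces of faces that contribute to the flag valuation of `gridBody` are
those spanned by a generator and the edges of the cube. -/
theorem exists_eq_generatorSpan {N : ℕ} (hN : 2 ≤ N) {M : Submodule ℝ (Euc d)}
    (hM : finrank ℝ M = n + 1) {u : Euc d} (hu : ‖u‖ = 1) (hcap : capDensity e u ≠ 0)
    (hprod : productDensity e Mᗮ ≠ 0)
    (hgen : vectorSpan ℝ (supportSet (gridBody e c s N) u) ≤ M)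
    (hvol : faceVolume (n + 1) (supportSet (gridBody e c s N) u) ≠ 0) :
    ∃ p : Fin N × Bool, generatorSpan e c s (gridNode N p.1) p.2 = M := by
  have hN0 : (1 / N : ℝ) ≠ 0 := by
    have : (N : ℝ) ≠ 0 := by exact_mod_cast (by omega : N ≠ 0)
    positivity
  have hW := isPolytope_gridBody e c s N
  have hdir : vectorSpan ℝ (supportSet (gridBody e c s N) u) = M := by
    refine Submodule.eq_of_le_of_finrank_le hgen ?_
    by_contra hlt
    refine hvol ?_
    rw [faceVolume, measureReal_def, euclideanHausdorffMeasure_eq_zero_of_finrank_lt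
      (hW.isCompact.isBounded.subset (supportSet_subset _ u)) (by omega), ENNReal.toReal_zero]
  have hsum := supportSet_gridBody he hcs hN hu hcap
  have hZne := supportSet_nonempty (isPolytope_zonotope _).isCompact
    (isPolytope_zonotope fun p : Fin N × Bool =>
      (1 / N : ℝ) • generator e c s (gridNode N p.1) p.2).nonempty u
  have hCne := supportSet_nonempty (isPolytope_zonotope _).isCompact
    (isPolytope_zonotope fun k : Fin n => e (.inr k)).nonempty u
  -- `u` is orthogonal to the cube: otherwise a coordinate is constant on the support set.
  have hperp : ∀ k, inner ℝ u (e (.inr k)) = 0 := by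
    intro k
    by_contra hk
    refine hprod (productDensity_eq_zero he (k := k) ?_)
    rw [← hdir, hsum]
    have hconst : ∀ x ∈ supportSet (gridZonotope e c s N) u +
        supportSet (zonotope fun k => e (.inr k)) u, inner ℝ (e (.inr k)) x =
          SignType.sign (inner ℝ u (e (.inr k)) : ℝ) := by
      rintro _ ⟨a, ⟨⟨t, -, rfl⟩, -⟩, b, hb, rfl⟩
      obtain ⟨r, -, hr, rfl⟩ := mem_supportSet_zonotope.1 hb
      simp only [inner_add_right, inner_sum, inner_smul_right, inner_inr_generator he,
        orthonormal_iff_ite.1 he, mul_zero, Finset.sum_const_zero, zero_add]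
      rw [← eq_sign_of_mul_eq_abs (hr k) hk]
      simp
    exact mem_orthogonal_vectorSpan fun x hx y hy => (hconst x hx).trans (hconst y hy).symm
  have hC : ∀ k, e (.inr k) ∈ M := fun k => by
    rw [← hdir, hsum]
    exact vectorSpan_le_vectorSpan_add_right hZne
      (mem_vectorSpan_supportSet_zonotope (v := fun k => e (.inr k)) (hperp k))
  -- Some generator is orthogonal to `u`: otherwise the dimension of the support set is too small.
  obtain ⟨p, hp⟩ : ∃ p : Fin N × Bool, inner ℝ u (generator e c s (gridNode N p.1) p.2) = 0 := by
    by_contra! hne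
    have hle : vectorSpan ℝ (supportSet (gridBody e c s N) u) ≤
        Submodule.span ℝ (Set.range fun k : Fin n => e (.inr k)) := by
      rw [hsum, gridZonotope, supportSet_zonotope_of_forall_ne (fun p => by
        rw [inner_smul_right]; exact mul_ne_zero hN0 (hne p)), Set.singleton_add]
      refine vectorSpan_le_of_subset_vadd (Set.image_mono ?_)
      exact (supportSet_subset _ _).trans (zonotope_subset_span _)
    rw [hdir] at hle
    have h1 := Submodule.finrank_mono hle
    have h2 := finrank_range_le_card (R := ℝ) fun k : Fin n => e (.inr k)
    rw [Fintype.card_fin, Set.finrank] at h2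
    omega
  refine ⟨p, Submodule.eq_of_le_of_finrank_eq (generatorSpan_le ?_ hC) ?_⟩
  · have h : (1 / N : ℝ) • generator e c s (gridNode N p.1) p.2 ∈ M := by
      rw [← hdir, hsum]
      exact vectorSpan_le_vectorSpan_add_left hCne
        (mem_vectorSpan_supportSet_zonotope (p := p)
          (v := fun p : Fin N × Bool => (1 / N : ℝ) • generator e c s (gridNode N p.1) p.2)
          (by rw [inner_smul_right, hp, mul_zero]))
    exact (Submodule.smul_mem_iff _ hN0).1 h
  · rw [finrank_generatorSpan he hcs, hM]

theorem faceVolume_supportSet_gridBody {N : ℕ} (hN : 2 ≤ N) (p : Fin N × Bool) {u : Euc d}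
    (hu : ‖u‖ = 1) (hcap : capDensity e u ≠ 0)
    (huM : u ∈ (generatorSpan e c s (gridNode N p.1) p.2)ᗮ)
    (hgen : vectorSpan ℝ (supportSet (gridBody e c s N) u) ≤
      generatorSpan e c s (gridNode N p.1) p.2) :
    faceVolume (n + 1) (supportSet (gridBody e c s N) u) =
      2 ^ (n + 1) * ‖generator e c s (gridNode N p.1) p.2‖ / N := by
  have hN' : (0 : ℝ) < N := by exact_mod_cast (by omega : 0 < N)
  have hN0 : (1 / N : ℝ) ≠ 0 := by positivity
  rw [mem_orthogonal_generatorSpan] at huM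
  have hsum := supportSet_gridBody he hcs hN hu hcap
  have hperp : ∀ k, inner ℝ u (e (.inr k)) = 0 := fun k => by rw [real_inner_comm, huM.2]
  have hp : inner ℝ u (generator e c s (gridNode N p.1) p.2) = 0 := by
    rw [real_inner_comm, huM.1]
  have hCne := supportSet_nonempty (isPolytope_zonotope _).isCompact
    (isPolytope_zonotope fun k : Fin n => e (.inr k)).nonempty u
  have huniq : ∀ q : Fin N × Bool, q ≠ p →
      inner ℝ u ((1 / N : ℝ) • generator e c s (gridNode N q.1) q.2) ≠ 0 := by
    intro q hqp hq
    have h : (1 / N : ℝ) • generator e c s (gridNode N q.1) q.2 ∈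
        generatorSpan e c s (gridNode N p.1) p.2 := by
      refine hgen ?_
      rw [hsum]
      exact vectorSpan_le_vectorSpan_add_left hCne
        (mem_vectorSpan_supportSet_zonotope (p := q)
          (v := fun p : Fin N × Bool => (1 / N : ℝ) • generator e c s (gridNode N p.1) p.2) hq)
    obtain ⟨h1, h2⟩ :=
      eq_of_generator_mem_generatorSpan he hcs ((Submodule.smul_mem_iff _ hN0).1 h)
    exact hqp (Prod.ext (Fin.ext (gridNode_injective (by omega) h1)) h2)
  set v := generator e c s (gridNode N p.1) p.2 with hv
  set m : Fin (n + 1) → Euc d := Fin.cons (‖v‖⁻¹ • v) fun k => e (.inr k) with hm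
  have hpos : 0 < ‖v‖ := norm_generator_pos he hcs _ _
  have hbox : (Fin.cons ((1 / N : ℝ) • v) fun k => e (.inr k) : Fin (n + 1) → Euc d) =
      fun i => (Fin.cons (‖v‖ / N) 1 : Fin (n + 1) → ℝ) i • m i := by
    ext1 i
    refine Fin.cases ?_ (fun k => ?_) i
    · simp only [hm, Fin.cons_zero, smul_smul]
      congr 1
      field_simp
    · simp [hm]
  rw [hsum, gridZonotope, supportSet_zonotope_of_unique (p := p)
    (v := fun p : Fin N × Bool => (1 / N : ℝ) • generator e c s (gridNode N p.1) p.2)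
    (by rw [inner_smul_right, ← hv, hp, mul_zero]) huniq,
    supportSet_zonotope_of_orthogonal hperp, ← hv, vadd_add_assoc, ← zonotope_cons, faceVolume,
    measureReal_def, measure_vadd, hbox,
    euclideanHausdorffMeasure_zonotope_smul (orthonormal_cons_generator he hcs _ _),
    ENNReal.toReal_ofReal, Fin.prod_univ_succ]
  · simp only [Fin.cons_zero, Fin.cons_succ, Pi.one_apply, Finset.prod_const, Finset.card_univ,
      Fintype.card_fin]
    ring
  · refine Finset.prod_nonneg fun i _ => mul_nonneg zero_le_two ?_
    refine Fin.cases ?_ (fun k => ?_) i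
    · simp only [Fin.cons_zero]
      positivity
    · simp
  · intro i
    refine Fin.cases ?_ (fun k => ?_) i
    · simp only [Fin.cons_zero]
      positivity
    · simp

/-- The integral of the cap density over the unit normals of a generator and the cube. -/
noncomputable def capIntegral (e : Fin 3 ⊕ Fin n → Euc d) (c s b : ℝ) (t : Bool) : ℝ :=
  ∫ u in ((generatorSpan e c s b t)ᗮ : Submodule ℝ (Euc d)) ∩ Metric.sphere 0 1, capDensity e u
    ∂(μHE[d - (n + 1) - 1] : Measure (Euc d))

theorem flagTerm_generatorSpan (hnd : n + 1 < d) {N : ℕ} (hN : 2 ≤ N) (p : Fin N × Bool) :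
    flagTerm (n + 1) (flagDensity e) (gridBody e c s N)
      (generatorSpan e c s (gridNode N p.1) p.2) =
      2 ^ (n + 1) * ‖generator e c s (gridNode N p.1) p.2‖ / N *
        (c * s / (1 + gridNode N p.1 ^ 2)) ^ 2 * capIntegral e c s (gridNode N p.1) p.2 := by
  have hM := finrank_generatorSpan he hcs (gridNode N p.1) p.2
  rw [flagTerm, if_pos hM, capIntegral, ← integral_const_mul]
  refine integral_congr_ae ?_
  filter_upwards [ae_vectorSpan_supportSet_le (isPolytope_gridBody e c s N) hM hnd,
    ae_restrict_mem (measurableSet_unitNormals _)] with u hu huM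
  rw [flagDensity, productDensity_generatorSpan, directionDensity_generatorSpan he hcs]
  by_cases hcap : capDensity e u = 0
  · simp [hcap]
  · rw [faceVolume_supportSet_gridBody he hcs hN p (by simpa using huM.2) hcap huM.1 hu]
    ring

theorem flagValuation_gridBody (hnd : n + 1 < d) {N : ℕ} (hN : 2 ≤ N) :
    flagValuation (n + 1) (flagDensity e) (gridBody e c s N) =
      ∑ p : Fin N × Bool, 2 ^ (n + 1) * ‖generator e c s (gridNode N p.1) p.2‖ / N *
        (c * s / (1 + gridNode N p.1 ^ 2)) ^ 2 * capIntegral e c s (gridNode N p.1) p.2 := by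
  classical
  have hinj : Function.Injective
      fun p : Fin N × Bool => generatorSpan e c s (gridNode N p.1) p.2 := by
    intro p q hpq
    have h := generator_mem_generatorSpan e c s (gridNode N p.1) p.2
    rw [show generatorSpan e c s (gridNode N p.1) p.2 = _ from hpq] at h
    obtain ⟨h1, h2⟩ := eq_of_generator_mem_generatorSpan he hcs h
    exact Prod.ext (Fin.ext (gridNode_injective (by omega) h1)) h2
  rw [flagValuation, finsum_eq_sum_of_support_subset (s := Finset.univ.image
    fun p : Fin N × Bool => generatorSpan e c s (gridNode N p.1) p.2), Finset.sum_image hinj.injOn]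
  · exact Finset.sum_congr rfl fun p _ => flagTerm_generatorSpan he hcs hnd hN p
  · intro M hM
    rw [Function.mem_support] at hM
    by_contra hnot
    refine hM ?_
    rw [flagTerm]
    split_ifs with hMd
    · refine integral_eq_zero_of_ae ?_
      filter_upwards [ae_vectorSpan_supportSet_le (isPolytope_gridBody e c s N) hMd hnd,
        ae_restrict_mem (measurableSet_unitNormals _)] with u hu huM
      by_contra h0
      simp only [flagDensity, Pi.zero_apply, mul_eq_zero, not_or] at h0
      obtain ⟨⟨hcap, hprod, -⟩, hvol⟩ := h0
      obtain ⟨p, hp⟩ := exists_eq_generatorSpan he hcs hN hMd (by simpa using huM.2) hcap hprod hu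
        hvol
      exact hnot (Finset.mem_coe.2 (Finset.mem_image.2 ⟨p, Finset.mem_univ p, hp⟩))
    · rfl

end

end Evaluation

/-! ### Bounds and the limit -/

section Bounds

open Module MeasureTheory Filter

variable {d n : ℕ}

theorem capIntegral_nonneg (e : Fin 3 ⊕ Fin n → Euc d) (c s b : ℝ) (t : Bool) :
    0 ≤ capIntegral e c s b t :=
  integral_nonneg fun u => capDensity_nonneg e u

section

variable {e : Fin 3 ⊕ Fin n → Euc d} (he : Orthonormal ℝ e)
include he

theorem neg_inner_two_le {u : Euc d} (hu : ‖u‖ = 1) : -inner ℝ u (e (.inl 2)) ≤ 1 := by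
  have h := abs_real_inner_le_norm u (e (.inl 2))
  rw [hu, he.norm_eq_one, one_mul] at h
  linarith [(abs_le.1 h).1]

variable {c s : ℝ} (hcs : c ^ 2 + s ^ 2 = 1)
include hcs

theorem capIntegral_le (hnd : n + 1 < d) (b : ℝ) (t : Bool) :
    capIntegral e c s b t ≤ (μHE[d - (n + 1) - 1] : Measure (EuclideanSpace ℝ
      (Fin (d - (n + 1) - 1 + 1)))).real (Metric.sphere 0 1) := by
  have hL := finrank_orthogonal_eq (finrank_generatorSpan he hcs b t) hnd
  rw [measureReal_def, ← euclideanHausdorffMeasure_inter_sphere_eq _ _ _ hL, capIntegral]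
  have h := norm_setIntegral_le_of_norm_le_const (C := 1) (f := capDensity e)
    (euclideanHausdorffMeasure_inter_sphere_lt_top _ hL) fun u hu => by
      rw [Real.norm_of_nonneg (capDensity_nonneg e u)]
      exact max_le zero_le_one (by linarith [neg_inner_two_le he (by simpa using hu.2 : ‖u‖ = 1)])
  rw [one_mul, Real.norm_eq_abs] at h
  exact (le_abs_self _).trans h

/-- If the generator is almost horizontal, it has a unit normal near the centre of the cap. -/
theorem le_capIntegral (hnd : n + 1 < d) {b : ℝ} (hb : |b| ≤ 1 / 100) (t : Bool) :
    1 / 2000 * (μHE[d - (n + 1) - 1] : Measure (EuclideanSpace ℝ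
      (Fin (d - (n + 1) - 1)))).real (Metric.closedBall 0 (1 / 4000 / 2)) ≤
      capIntegral e c s b t := by
  set m := d - (n + 1) - 1
  set L := (generatorSpan e c s b t)ᗮ with hLdef
  have hL : finrank ℝ L = m + 1 := finrank_orthogonal_eq (finrank_generatorSpan he hcs b t) hnd
  set v := generator e c s b t with hv
  set r : ℝ := Real.sqrt (1 + b ^ 2) with hr
  have hr2 : r ^ 2 = 1 + b ^ 2 := Real.sq_sqrt (by positivity)
  have hr1 : 1 ≤ r := Real.one_le_sqrt.2 (by nlinarith [sq_nonneg b])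
  have hr0 : r ≠ 0 := by positivity
  have hvv : inner ℝ v v = r ^ 2 := by
    rw [real_inner_self_eq_norm_sq, norm_sq_generator he c s b t hcs, hr2]
  have hv2 : inner ℝ v (e (.inl 2)) = b := by
    rw [real_inner_comm, inner_two_generator he]
  have h22 : inner ℝ (e (.inl 2)) (e (.inl 2)) = (1 : ℝ) := by
    rw [real_inner_self_eq_norm_sq, he.norm_eq_one, one_pow]
  -- The downward unit normal of the generator in its vertical plane.
  set w : Euc d := r⁻¹ • (b • v - r ^ 2 • e (.inl 2)) with hw
  have hwL : w ∈ L := by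
    rw [hLdef, mem_orthogonal_generatorSpan]
    refine ⟨?_, fun k => ?_⟩
    · rw [hw, inner_smul_right, inner_sub_right, inner_smul_right, inner_smul_right, ← hv, hvv, hv2]
      ring
    · rw [hw, inner_smul_right, inner_sub_right, inner_smul_right, inner_smul_right, hv,
        inner_inr_generator he, he.inner_eq_zero (by simp)]
      ring
  have hw2 : inner ℝ w (e (.inl 2)) = -r⁻¹ := by
    rw [hw, inner_smul_left, inner_sub_left, inner_smul_left, inner_smul_left, hv2, h22]
    simp only [conj_trivial]
    rw [hr2]
    ring
  have hwv : inner ℝ w v = 0 := by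
    rw [real_inner_comm]
    exact (mem_orthogonal_generatorSpan.1 hwL).1
  have hw1 : ‖w‖ = 1 := by
    have : ‖w‖ ^ 2 = 1 := by
      rw [← real_inner_self_eq_norm_sq]
      nth_rw 2 [hw]
      rw [inner_smul_right, inner_sub_right, inner_smul_right, inner_smul_right, hwv, hw2]
      field_simp
      ring
    exact (pow_eq_one_iff_of_nonneg (norm_nonneg _) two_ne_zero).1 this
  have hrinv : 1 - 1 / 20000 ≤ r⁻¹ := by
    have hb2 : b ^ 2 ≤ 1 / 10000 := by
      rw [← sq_abs]
      nlinarith [abs_nonneg b]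
    have : r ≤ 1 + 1 / 20000 := by nlinarith
    rw [← one_div, le_div_iff₀ (by positivity)]
    nlinarith
  set A : Set (Euc d) := {u | u ∈ L ∧ ‖u‖ = 1 ∧ ‖u - w‖ ≤ 1 / 4000} with hA
  have hsub : A ⊆ (L : Set (Euc d)) ∩ Metric.sphere 0 1 :=
    fun u hu => ⟨hu.1, by simpa using hu.2.1⟩
  have hAm : MeasurableSet A := by
    refine (L.closed_of_finiteDimensional.inter ?_).measurableSet
    exact (isClosed_eq continuous_norm continuous_const).inter
      (isClosed_le (f := fun u => ‖u - w‖) (by fun_prop) continuous_const)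
  have hfin := euclideanHausdorffMeasure_inter_sphere_lt_top L hL
  have hint := integrableOn_unitNormals hL (continuous_capDensity e)
  have hge : ∀ u ∈ A, 1 / 2000 ≤ capDensity e u := by
    rintro u ⟨-, -, hu⟩
    refine le_max_of_le_right ?_
    have h := abs_real_inner_le_norm (u - w) (e (.inl 2))
    rw [he.norm_eq_one, mul_one, inner_sub_left, hw2] at h
    linarith [(abs_le.1 h).2]
  calc 1 / 2000 * (μHE[m] : Measure (EuclideanSpace ℝ (Fin m))).real
        (Metric.closedBall 0 (1 / 4000 / 2))
      ≤ 1 / 2000 * (μHE[m] : Measure (Euc d)).real A := by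
        refine mul_le_mul_of_nonneg_left ?_ (by norm_num)
        exact ENNReal.toReal_mono ((measure_mono hsub).trans_lt hfin).ne
          (euclideanHausdorffMeasure_closedBall_le_cap L hL hwL hw1 (by norm_num) (by norm_num))
    _ ≤ ∫ u in A, capDensity e u ∂(μHE[m] : Measure (Euc d)) :=
        setIntegral_ge_of_const_le_real hAm ((measure_mono hsub).trans_lt hfin).ne hge
          (hint.mono_set hsub)
    _ ≤ capIntegral e c s b t :=
        setIntegral_mono_set hint (Eventually.of_forall fun u => capDensity_nonneg e u)
          hsub.eventuallyLE

theorem one_le_norm_generator (b : ℝ) (t : Bool) : 1 ≤ ‖generator e c s b t‖ := by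
  have h := norm_sq_generator he c s b t hcs
  nlinarith [norm_nonneg (generator e c s b t), sq_nonneg b]

theorem norm_generator_le {b : ℝ} (hb : |b| ≤ 1) (t : Bool) : ‖generator e c s b t‖ ≤ 2 := by
  have h := norm_sq_generator he c s b t hcs
  have hb2 : b ^ 2 ≤ 1 := by
    rw [← sq_abs]
    nlinarith [abs_nonneg b]
  nlinarith [norm_nonneg (generator e c s b t)]

theorem flagValuation_gridBody_le (hnd : n + 1 < d) {N : ℕ} (hN : 2 ≤ N) :
    flagValuation (n + 1) (flagDensity e) (gridBody e c s N) ≤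
      2 ^ (n + 1) * 4 * (μHE[d - (n + 1) - 1] : Measure (EuclideanSpace ℝ
        (Fin (d - (n + 1) - 1 + 1)))).real (Metric.sphere 0 1) := by
  have hN' : (0 : ℝ) < N := by exact_mod_cast (by omega : 0 < N)
  set C := (μHE[d - (n + 1) - 1] : Measure (EuclideanSpace ℝ
    (Fin (d - (n + 1) - 1 + 1)))).real (Metric.sphere 0 1)
  rw [flagValuation_gridBody he hcs hnd hN]
  calc _ ≤ ∑ p : Fin N × Bool, 2 ^ (n + 1) * 2 / N * 1 * C := by
        refine Finset.sum_le_sum fun p _ => ?_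
        have h1 : (c * s / (1 + gridNode N p.1 ^ 2)) ^ 2 ≤ 1 := by
          rw [sq_le_one_iff_abs_le_one, abs_div, abs_of_pos (a := 1 + _) (by positivity)]
          refine div_le_one_of_le₀ ?_ (by positivity)
          rw [abs_le]
          constructor <;>
            nlinarith [sq_nonneg (c - s), sq_nonneg (c + s), sq_nonneg (gridNode N p.1)]
        have h2 := norm_generator_le he hcs (abs_gridNode_le p.1.2) p.2
        have h3 := capIntegral_le he hcs hnd (gridNode N p.1) p.2
        have h4 := capIntegral_nonneg e c s (gridNode N p.1) p.2
        gcongr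
    _ = _ := by
        rw [Finset.sum_const, Finset.card_univ, Fintype.card_prod, Fintype.card_fin,
          Fintype.card_bool, nsmul_eq_mul]
        push_cast
        field_simp
        ring

end

theorem abs_gridNode_le_of_middle {k i : ℕ} (h1 : 99 * (k + 1) ≤ i) (h2 : i < 101 * (k + 1)) :
    |gridNode (200 * (k + 1)) i| ≤ 1 / 100 := by
  have h1' : (99 : ℝ) * (k + 1) ≤ i := by exact_mod_cast h1
  have h2' : (i : ℝ) + 1 ≤ 101 * (k + 1) := by exact_mod_cast h2
  have hk : (0 : ℝ) < 200 * (k + 1) := by positivity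
  rw [gridNode, abs_le]
  push_cast
  constructor
  · rw [le_sub_iff_add_le, le_div_iff₀ hk]
    linarith
  · rw [sub_le_iff_le_add, div_le_iff₀ hk]
    linarith

/-- For a rotation that does not preserve the coordinate axes, a fixed proportion of the
generators makes a contribution that is bounded below. -/
theorem le_flagValuation_gridBody {e : Fin 3 ⊕ Fin n → Euc d} (he : Orthonormal ℝ e)
    (hnd : n + 1 < d) (k : ℕ) :
    2 ^ (n + 1) * (6 / 25) ^ 2 / 100 * (1 / 2000 * (μHE[d - (n + 1) - 1] :
        Measure (EuclideanSpace ℝ (Fin (d - (n + 1) - 1)))).real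
          (Metric.closedBall 0 (1 / 4000 / 2))) ≤
      flagValuation (n + 1) (flagDensity e) (gridBody e (3 / 5) (4 / 5) (200 * (k + 1))) := by
  have hcs : (3 / 5 : ℝ) ^ 2 + (4 / 5) ^ 2 = 1 := by norm_num
  set C := 1 / 2000 * (μHE[d - (n + 1) - 1] :
    Measure (EuclideanSpace ℝ (Fin (d - (n + 1) - 1)))).real (Metric.closedBall 0 (1 / 4000 / 2))
    with hC
  have hC0 : 0 ≤ C := by positivity
  obtain ⟨N, hN⟩ : ∃ N, N = 200 * (k + 1) := ⟨_, rfl⟩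
  rw [← hN]
  have hN' : (N : ℝ) = 200 * (k + 1) := by rw [hN]; push_cast; ring
  have hk : (0 : ℝ) < k + 1 := by positivity
  rw [flagValuation_gridBody he hcs hnd (by omega), Fintype.sum_prod_type]
  set f : ℕ → ℝ := fun i => if i ∈ Finset.Ico (99 * (k + 1)) (101 * (k + 1)) then
    2 ^ (n + 1) * 1 / N * (6 / 25) ^ 2 * C else 0 with hf
  calc 2 ^ (n + 1) * (6 / 25) ^ 2 / 100 * C = ∑ i ∈ Finset.range N, f i := by
        rw [hf, Finset.sum_ite_mem, Finset.sum_const, nsmul_eq_mul,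
          Finset.inter_eq_right.2 (fun i hi => by
            rw [Finset.mem_Ico] at hi
            rw [Finset.mem_range]
            omega), Nat.card_Ico, hN', show 101 * (k + 1) - 99 * (k + 1) = 2 * (k + 1) by omega]
        push_cast
        field_simp
        ring
    _ = ∑ i : Fin N, f i := Finset.sum_range _
    _ ≤ _ := by
        refine Finset.sum_le_sum fun i _ => ?_
        rw [Fintype.sum_bool]
        have hnonneg : ∀ t, 0 ≤ 2 ^ (n + 1) * ‖generator e (3 / 5) (4 / 5) (gridNode N i) t‖ / N *
            (3 / 5 * (4 / 5) / (1 + gridNode N i ^ 2)) ^ 2 *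
              capIntegral e (3 / 5) (4 / 5) (gridNode N i) t := fun t => by
          have := capIntegral_nonneg e (3 / 5) (4 / 5) (gridNode N i) t
          positivity
        refine le_add_of_le_of_nonneg ?_ (hnonneg false)
        rw [hf]
        dsimp only
        split_ifs with hi
        · rw [Finset.mem_Ico] at hi
          have hb := abs_gridNode_le_of_middle hi.1 hi.2
          rw [← hN] at hb
          have h1 := one_le_norm_generator he hcs (gridNode N i) true
          have h2 := le_capIntegral he hcs hnd hb true
          have h3 : (6 / 25 : ℝ) ≤ 3 / 5 * (4 / 5) / (1 + gridNode N i ^ 2) := by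
            rw [le_div_iff₀ (by positivity)]
            have : gridNode N i ^ 2 ≤ 1 := by
              rw [← sq_abs]
              nlinarith [abs_nonneg (gridNode N i)]
            nlinarith
          gcongr
        · exact hnonneg true

theorem exists_orthonormal_family (hnd : n + 3 ≤ d) :
    ∃ e : Fin 3 ⊕ Fin n → Euc d, Orthonormal ℝ e := by
  refine ⟨_, (EuclideanSpace.basisFun (Fin d) ℝ).orthonormal.comp
    (fun i => Fin.castLE (by omega) (finSumFinEquiv (m := 3) (n := n) i)) ?_⟩
  exact (Fin.castLE_injective _).comp finSumFinEquiv.injective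

end Bounds

theorem theorem2p1 (d j : ℕ) (hj : 1 ≤ j) (hjd : j + 2 ≤ d) :
    ∃ φ : Set (Euc d) → ℝ,
      IsPolytopeValuation φ ∧ IsTranslationInvariant φ ∧ IsHomogeneousOfDegree j φ ∧
      IsFlagContinuous j φ ∧
      (∃ (K : ConvexBody (Euc d)) (P Q : ℕ → ConvexBody (Euc d)) (a b : ℝ),
        (∀ k, IsPolytope (P k : Set (Euc d))) ∧ (∀ k, IsPolytope (Q k : Set (Euc d))) ∧
        Filter.Tendsto P Filter.atTop (𝓝 K) ∧ Filter.Tendsto Q Filter.atTop (𝓝 K) ∧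
        Filter.Tendsto (fun k => φ (P k : Set (Euc d))) Filter.atTop (𝓝 a) ∧
        Filter.Tendsto (fun k => φ (Q k : Set (Euc d))) Filter.atTop (𝓝 b) ∧
        a ≠ b) ∧
      ¬ ∃ ψ : ConvexBody (Euc d) → ℝ, Continuous ψ ∧
        ∀ P : ConvexBody (Euc d), IsPolytope (P : Set (Euc d)) → ψ P = φ (P : Set (Euc d)) := by
  obtain ⟨n, rfl⟩ : ∃ n, j = n + 1 := ⟨j - 1, by omega⟩
  obtain ⟨e, he⟩ := exists_orthonormal_family (n := n) (d := d) (by omega)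
  have hnd : n + 1 < d := by omega
  have hg : ∀ L, Continuous fun u => flagDensity e (u, L) := fun L =>
    (continuous_flagDensity e).comp (by fun_prop)
  have hcs1 : (1 : ℝ) ^ 2 + 0 ^ 2 = 1 := by norm_num
  have hcs2 : (3 / 5 : ℝ) ^ 2 + (4 / 5) ^ 2 = 1 := by norm_num
  set φ : Set (Euc d) → ℝ := flagValuation (n + 1) (flagDensity e) with hφ
  set P : ℕ → ConvexBody (Euc d) :=
    fun k => (isPolytope_gridBody e 1 0 (200 * (k + 1))).toConvexBody with hP
  set Q : ℕ → ConvexBody (Euc d) :=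
    fun k => (isPolytope_gridBody e (3 / 5) (4 / 5) (200 * (k + 1))).toConvexBody with hQ
  have herr : ∀ {c s : ℝ}, c ^ 2 + s ^ 2 = 1 → ∀ (k : ℕ) (u : Euc d), ‖u‖ = 1 →
      |max (gridSupport c s (200 * (k + 1)) (inner ℝ u (e (.inl 0))) (inner ℝ u (e (.inl 1)))
          (inner ℝ u (e (.inl 2)))) (4 * (|inner ℝ u (e (.inl 0))| + |inner ℝ u (e (.inl 1))|)) +
          ∑ k, |inner ℝ u (e (.inr k))| -
        (max (paraboloidSupport (inner ℝ u (e (.inl 0))) (inner ℝ u (e (.inl 1)))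
          (inner ℝ u (e (.inl 2)))) (4 * (|inner ℝ u (e (.inl 0))| + |inner ℝ u (e (.inl 1))|)) +
          ∑ k, |inner ℝ u (e (.inr k))|)| ≤ 1 / ((k : ℝ) + 1) := by
    intro c s hcs k u hu
    rw [add_sub_add_right_eq_sub]
    refine (abs_max_gridSupport_sub_le hcs (by omega) _ _ _).trans ?_
    have h := abs_real_inner_le_norm u (e (.inl 2))
    rw [hu, he.norm_eq_one, one_mul] at h
    refine div_le_div₀ zero_le_one h (by positivity) ?_
    push_cast
    nlinarith [(Nat.cast_nonneg k : (0 : ℝ) ≤ k)]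
  obtain ⟨K, hPK, hQK⟩ := exists_tendsto_of_supportFunction (P := P) (Q := Q)
    (fun k => isSupportFunction_gridBody e 1 0 (200 * (k + 1)))
    (fun k => isSupportFunction_gridBody e (3 / 5) (4 / 5) (200 * (k + 1)))
    (ε := fun k => 1 / ((k : ℝ) + 1))
    (fun k l hkl => one_div_le_one_div_of_le (by positivity) (by exact_mod_cast Nat.succ_le_succ hkl))
    tendsto_one_div_add_atTop_nhds_zero_nat (herr hcs1) (herr hcs2)
  have hφP : ∀ k, φ (P k) = 0 := by
    intro k
    change flagValuation (n + 1) (flagDensity e) (gridBody e 1 0 (200 * (k + 1))) = 0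
    rw [flagValuation_gridBody he hcs1 hnd (by omega)]
    simp
  obtain ⟨b, ⟨hb, -⟩, σ, hσ, hσb⟩ := isCompact_Icc.tendsto_subseq (x := fun k => φ (Q k)) fun k =>
    ⟨le_flagValuation_gridBody he hnd k, flagValuation_gridBody_le he hcs2 hnd (by omega)⟩
  have hb0 : 0 < b := by
    refine lt_of_lt_of_le ?_ hb
    have hball : 0 < (μHE[d - (n + 1) - 1] : MeasureTheory.Measure (EuclideanSpace ℝ
        (Fin (d - (n + 1) - 1)))).real (Metric.closedBall 0 (1 / 4000 / 2)) := by
      rw [EuclideanSpace.euclideanHausdorffMeasure_eq_volume]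
      exact ENNReal.toReal_pos (Metric.measure_closedBall_pos _ _ (by norm_num)).ne'
        MeasureTheory.measure_closedBall_lt_top.ne
    positivity
  have hφP' : Filter.Tendsto (fun k => φ (P k)) Filter.atTop (𝓝 0) := by
    simp only [hφP]
    exact tendsto_const_nhds
  refine ⟨φ, isPolytopeValuation_flagValuation hnd hg, isTranslationInvariant_flagValuation,
    isHomogeneousOfDegree_flagValuation hj,
    isFlagContinuous_flagValuation hnd hg (continuous_flagDensity e).continuousOn,
    ⟨K, P, Q ∘ σ, 0, b, fun k => isPolytope_gridBody _ _ _ _, fun k => isPolytope_gridBody _ _ _ _,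
      hPK, hQK.comp hσ.tendsto_atTop, hφP', hσb, hb0.ne⟩, ?_⟩
  rintro ⟨ψ, hψ, hψφ⟩
  have h1 : Filter.Tendsto (fun k => φ (P k)) Filter.atTop (𝓝 (ψ K)) := by
    refine ((hψ.tendsto K).comp hPK).congr fun k => ?_
    exact hψφ _ (isPolytope_gridBody _ _ _ _)
  have h2 : Filter.Tendsto (fun k => φ (Q (σ k))) Filter.atTop (𝓝 (ψ K)) := by
    refine ((hψ.tendsto K).comp (hQK.comp hσ.tendsto_atTop)).congr fun k => ?_
    exact hψφ _ (isPolytope_gridBody _ _ _ _)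
  exact hb0.ne ((tendsto_nhds_unique hφP' h1).trans (tendsto_nhds_unique hσb h2).symm)
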